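/- Let $a>0$, $\Omega=(-a,a)$, let $K:\Omega\times\Omega\to\mathbb R$ be a kernel such that all partial derivatives $K^{(i,j)}=\frac{\partial^{i+j}K}{\partial x^i\partial y^j}$, $0\le i,j\le n$, exist and are continuous on $\Omega\times\Omega$, and let $x_1,\dots,x_n\in\mathbb R$ be arbitrary points. For small $\varepsilon\ge 0$ put $\mathbf K_\varepsilon=[K(\varepsilon x_i,\varepsilon x_j)]_{i,j=1}^n$. Assume that for some $\varepsilon_0>0$ the matrix $\mathbf K_\varepsilon$ is symmetric positive semidefinite for all $\varepsilon\in[0,\varepsilon_0]$, and that $\mathbf K_\varepsilon$ is analytic in $\varepsilon$ near $0$, i.e. for small $\varepsilon\ge0$ its entries coincide with power series in $\varepsilon$ convergent in a neighbourhood of $0$. Let $\lambda_1(\varepsilon)\ge\dots\ge\lambda_n(\varepsilon)\ge 0$ be the eigenvalues of $\mathbf K_\varepsilon$, counted with multiplicity. Then there are real numbers $\widetilde\lambda_1,\dots,\widetilde\lambda_n$ such that for every $1\le s\le n$, as $\varepsilon\to0$, $\varepsilon\ge 0$, $$\lambda_s(\varepsilon)=\varepsilon^{2(s-1)}\bigl(\widetilde\lambda_s+O(\varepsilon)\bigr),$$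 and for every $1\le s\le n$ $$\widetilde\lambda_1\cdots\widetilde\lambda_s=\det\bigl(V_{\le s-1}^{\mathsf T}V_{\le s-1}\bigr)\,\det W_{\le s-1},$$ where $V_{\le k}=[x_i^{\,j}]_{1\le i\le n,\;0\le j\le k}$ is the Vandermonde matrix and $W_{\le k}=\Bigl[\frac{K^{(i,j)}(0,0)}{i!\,j!}\Bigr]_{0\le i,j\le k}$ is the Wronskian matrix of $K$. -/

import Mathlib

noncomputable section

/-- The mixed partial derivative `K^{(i,j)} = ∂^{i+j} K / ∂x^i ∂y^j` at `(x, y)`: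
`j` derivatives in the second variable, then `i` derivatives in the first. -/
def mixedDeriv (K : ℝ → ℝ → ℝ) (i j : ℕ) (x y : ℝ) : ℝ :=
  iteratedDeriv i (fun u => iteratedDeriv j (K u) y) x

/-- The class `C^{(l,l)}` on `Ω = (-a, a)`: all the mixed partial derivatives `K^{(i,j)}`,
`0 ≤ i, j ≤ l`, exist and are continuous on `Ω × Ω`. The first two fields say that each further
derivative, in the second variable and then in the first, really exists. -/
structure IsKernelOfClass (l : ℕ) (a : ℝ) (K : ℝ → ℝ → ℝ) : Prop where
  differentiable_snd : ∀ j < l, ∀ x ∈ Set.Ioo (-a) a, ∀ y ∈ Set.Ioo (-a) a,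
    DifferentiableAt ℝ (fun v => mixedDeriv K 0 j x v) y
  differentiable_fst : ∀ i < l, ∀ j ≤ l, ∀ x ∈ Set.Ioo (-a) a, ∀ y ∈ Set.Ioo (-a) a,
    DifferentiableAt ℝ (fun u => mixedDeriv K i j u y) x
  continuousOn : ∀ i ≤ l, ∀ j ≤ l,
    ContinuousOn (fun p : ℝ × ℝ => mixedDeriv K i j p.1 p.2)
      (Set.Ioo (-a) a ×ˢ Set.Ioo (-a) a)

/-- The scaled kernel matrix `K_ε = [K(ε x_i, ε x_j)]`. -/
def scaledKernelMatrix {n : ℕ} (K : ℝ → ℝ → ℝ) (x : Fin n → ℝ) (ε : ℝ) :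
    Matrix (Fin n) (Fin n) ℝ :=
  Matrix.of fun i j => K (ε * x i) (ε * x j)

/-- The Wronskian matrix `W_{≤ k}`, with entries `K^{(i,j)}(0,0) / (i! j!)`, `0 ≤ i, j ≤ k`. -/
def wronskianMatrix (K : ℝ → ℝ → ℝ) (k : ℕ) : Matrix (Fin (k + 1)) (Fin (k + 1)) ℝ :=
  Matrix.of fun i j =>
    mixedDeriv K i j 0 0 / ((Nat.factorial i : ℝ) * (Nat.factorial j : ℝ))

/-- The `n × (k + 1)` Vandermonde matrix `V_{≤ k}` of the nodes `x`, with entries `x_i ^ j`,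
`0 ≤ j ≤ k`. -/
def vandermondeUpTo {n : ℕ} (x : Fin n → ℝ) (k : ℕ) : Matrix (Fin n) (Fin (k + 1)) ℝ :=
  Matrix.of fun i j => x i ^ (j : ℕ)

open scoped Classical in
/-- The eigenvalues of a real symmetric matrix, counted with multiplicity and listed in
nonincreasing order from the index `0` on (`0` by convention if the matrix is not symmetric). -/
def sortedEigenvalue {n : ℕ} (A : Matrix (Fin n) (Fin n) ℝ) (s : Fin n) : ℝ :=
  if hA : A.IsHermitian then hA.eigenvalues₀ (Fin.cast (Fintype.card_fin n).symm s) else 0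

end

open Polynomial Filter
open scoped Topology Matrix

/-! Index the eigenvalues from `0`. Gram–Schmidt on the Vandermonde columns gives an orthogonal `Q`
whose column `p` annihilates all monomials of degree `< p` on the nodes, also when nodes coincide
(`exists_orthogonal_annihilating`). A mean value argument in each variable then shows that entry
`(p, q)` of `Qᵀ K_ε Q` is `ε^(p+q) (M p q + o(1))`, where `M = D W D` with `D` diagonal and `W` the
Wronskian matrix (`IsKernelOfClass.tendsto_bilin`).

This grading has two consequences. By min-max and positivity, `λ_s = O(ε^(2s))`
(`isBigO_sortedEigenvalue_of_graded`). And if the limits `μ_i` of `λ_i / ε^(2i)` exist, rescaling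
the rows and columns of `ε^(2s+1) I + Qᵀ K_ε Q` identifies `μ_0 ⋯ μ_s` with the leading minor of `M`
(`prod_leading_eq_det_of_graded`). That minor is the stated product because `Qᵀ V` is upper
triangular with the entries of `D` on its diagonal.

Smoothness alone yields only `o(1)`. The existence of the limits and the `O(ε)` remainder come from
Rellich's theorem: for `ε ≥ 0` the sorted eigenvalues are restrictions of functions analytic at `0`,
so the bound `O(ε^(2s))` lets one factor out `ε^(2s)` analytically. Rellich's theorem is proved for
real-rooted monic polynomials by induction on the degree: centre the roots, scale out their common
order of vanishing, and split the limit polynomial by Hensel's lemma. -/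

/-! ### Monic polynomials as coefficient vectors, and Hensel's lemma -/

/-- The monic polynomial of degree `n` with prescribed lower coefficients. -/
noncomputable def monicPoly {n : ℕ} (u : Fin n → ℝ) : ℝ[X] :=
  X ^ n + ∑ i : Fin n, C (u i) * X ^ (i : ℕ)

/-- The polynomial of degree `< n` with prescribed coefficients. -/
noncomputable def lowPoly {n : ℕ} (u : Fin n → ℝ) : ℝ[X] :=
  ∑ i : Fin n, C (u i) * X ^ (i : ℕ)

lemma degree_lowPoly_lt {n : ℕ} (u : Fin n → ℝ) : (lowPoly u).degree < n :=
  degree_sum_fin_lt u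

lemma monicPoly_eq {n : ℕ} (u : Fin n → ℝ) : monicPoly u = X ^ n + lowPoly u := rfl

lemma monic_monicPoly {n : ℕ} (u : Fin n → ℝ) : (monicPoly u).Monic :=
  monic_X_pow_add (degree_lowPoly_lt u)

lemma natDegree_monicPoly {n : ℕ} (u : Fin n → ℝ) : (monicPoly u).natDegree = n := by
  have h : (monicPoly u).degree = n := by
    rw [monicPoly_eq, degree_add_eq_left_of_degree_lt] <;> rw [degree_X_pow]
    exact degree_lowPoly_lt u
  exact natDegree_eq_of_degree_eq_some h

lemma coeff_lowPoly {n : ℕ} (u : Fin n → ℝ) (k : ℕ) :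
    (lowPoly u).coeff k = if h : k < n then u ⟨k, h⟩ else 0 := by
  simp only [lowPoly, finsetSum_coeff, coeff_C_mul, coeff_X_pow]
  split_ifs with h
  · rw [Finset.sum_eq_single ⟨k, h⟩]
    · simp
    · intro b _ hb
      have : k ≠ b := fun h' => hb (Fin.ext h'.symm)
      simp [this]
    · simp
  · refine Finset.sum_eq_zero fun i _ => ?_
    have : k ≠ i := by omega
    simp [this]

lemma coeff_monicPoly {n : ℕ} (u : Fin n → ℝ) (k : ℕ) :
    (monicPoly u).coeff k = (if k = n then 1 else 0) + if h : k < n then u ⟨k, h⟩ else 0 := by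
  rw [monicPoly_eq, coeff_add, coeff_lowPoly, coeff_X_pow]

lemma coeff_monicPoly_fin {n : ℕ} (u : Fin n → ℝ) (k : Fin n) :
    (monicPoly u).coeff k = u k := by
  rw [coeff_monicPoly, if_neg k.2.ne, dif_pos k.2, zero_add]

lemma monicPoly_injective {n : ℕ} : Function.Injective (monicPoly (n := n)) := fun u v h => by
  ext k
  rw [← coeff_monicPoly_fin u, h, coeff_monicPoly_fin]

lemma eq_monicPoly {n : ℕ} {P : ℝ[X]} (hP : P.Monic) (hn : P.natDegree = n) :
    P = monicPoly fun i : Fin n => P.coeff i := by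
  ext k
  rw [coeff_monicPoly]
  rcases lt_trichotomy k n with h | h | h
  · simp [h, h.ne]
  · subst h; simpa using hn ▸ hP.coeff_natDegree
  · simp [h.not_gt, h.ne', coeff_eq_zero_of_natDegree_lt (hn ▸ h)]

lemma lowPoly_eq_zero {n : ℕ} {u : Fin n → ℝ} (h : lowPoly u = 0) : u = 0 := by
  ext k
  have := coeff_lowPoly u k
  simpa [h] using this.symm

/-- The multiplication of monic polynomials, on coefficient vectors. -/
noncomputable def mulCoeff {p q : ℕ} (z : (Fin p → ℝ) × (Fin q → ℝ)) (k : Fin (p + q)) : ℝ :=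
  (monicPoly z.1 * monicPoly z.2).coeff k

lemma monicPoly_mulCoeff {p q : ℕ} (z : (Fin p → ℝ) × (Fin q → ℝ)) :
    monicPoly (mulCoeff z) = monicPoly z.1 * monicPoly z.2 := by
  refine (eq_monicPoly ((monic_monicPoly _).mul (monic_monicPoly _)) ?_).symm
  rw [(monic_monicPoly _).natDegree_mul (monic_monicPoly _), natDegree_monicPoly,
    natDegree_monicPoly]

lemma analyticAt_coeff_monicPoly {E : Type*} [NormedAddCommGroup E] [NormedSpace ℝ E] {n : ℕ}
    {f : E → Fin n → ℝ} {z : E} (hf : AnalyticAt ℝ f z) (k : ℕ) :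
    AnalyticAt ℝ (fun e => (monicPoly (f e)).coeff k) z := by
  simp only [coeff_monicPoly]
  refine analyticAt_const.add ?_
  split_ifs with h
  · exact analyticAt_pi_iff.1 hf ⟨k, h⟩
  · exact analyticAt_const

lemma analyticAt_mulCoeff {p q : ℕ} (z : (Fin p → ℝ) × (Fin q → ℝ)) :
    AnalyticAt ℝ (mulCoeff (p := p) (q := q)) z := by
  refine analyticAt_pi_iff.2 fun k => ?_
  simp only [mulCoeff, coeff_mul]
  exact Finset.analyticAt_fun_sum _ fun i _ =>
    (analyticAt_coeff_monicPoly analyticAt_fst _).mul (analyticAt_coeff_monicPoly analyticAt_snd _)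

lemma monicPoly_add_smul {n : ℕ} (u v : Fin n → ℝ) (t : ℝ) :
    monicPoly (u + t • v) = monicPoly u + C t * lowPoly v := by
  simp only [monicPoly, lowPoly, Finset.mul_sum, add_assoc, ← Finset.sum_add_distrib]
  congr 1
  refine Finset.sum_congr rfl fun i _ => ?_
  simp only [Pi.add_apply, Pi.smul_apply, smul_eq_mul, C_add, C_mul]
  ring

/-- Along a line `z + t w` the product is quadratic in `t`, so the directional derivative is its
linear coefficient. -/
lemma fderiv_mulCoeff_apply {p q : ℕ} (z w : (Fin p → ℝ) × (Fin q → ℝ)) (k : Fin (p + q)) :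
    fderiv ℝ mulCoeff z w k =
      (lowPoly w.1 * monicPoly z.2 + monicPoly z.1 * lowPoly w.2).coeff k := by
  have h1 : HasDerivAt (fun t : ℝ => z + t • w) w 0 := by
    simpa using ((hasDerivAt_id (0 : ℝ)).smul_const w).const_add z
  have h2 : HasFDerivAt mulCoeff (fderiv ℝ mulCoeff z) (z + (0 : ℝ) • w) := by
    simpa using (analyticAt_mulCoeff z).differentiableAt.hasFDerivAt
  have h3 := hasDerivAt_pi.1 (h2.comp_hasDerivAt (0 : ℝ) h1) k
  have h4 : (fun t : ℝ => (mulCoeff ∘ fun t : ℝ => z + t • w) t k) = fun t =>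
      (monicPoly z.1 * monicPoly z.2).coeff k +
      t * (lowPoly w.1 * monicPoly z.2 + monicPoly z.1 * lowPoly w.2).coeff k +
      t ^ 2 * (lowPoly w.1 * lowPoly w.2).coeff k := by
    ext t
    simp only [Function.comp, mulCoeff, Prod.fst_add, Prod.snd_add, Prod.smul_fst, Prod.smul_snd,
      monicPoly_add_smul]
    rw [← coeff_C_mul, ← coeff_C_mul, ← coeff_add, ← coeff_add]
    congr 1
    simp only [C_pow]
    ring
  rw [h4] at h3
  refine h3.unique ?_
  have h5 := (((hasDerivAt_id (0 : ℝ)).mul_const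
    ((lowPoly w.1 * monicPoly z.2 + monicPoly z.1 * lowPoly w.2).coeff k)).const_add
    ((monicPoly z.1 * monicPoly z.2).coeff k)).add
    ((hasDerivAt_pow 2 (0 : ℝ)).mul_const ((lowPoly w.1 * lowPoly w.2).coeff k))
  refine (h5.congr_deriv (by simp)).congr_of_eventuallyEq (Eventually.of_forall fun t => ?_)
  simp

/-- If `a g + f b = 0` with `f`, `g` coprime, then `f ∣ a`, and `deg a < deg f` forces `a = 0`,
hence `b = 0`. -/
lemma fderiv_mulCoeff_injective {p q : ℕ} {z : (Fin p → ℝ) × (Fin q → ℝ)}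
    (hz : IsCoprime (monicPoly z.1) (monicPoly z.2)) :
    Function.Injective (fderiv ℝ (mulCoeff (p := p) (q := q)) z) := by
  refine (injective_iff_map_eq_zero _).2 fun w hw => ?_
  have hdeg : ∀ {n m : ℕ} (u : Fin n → ℝ) (v : Fin m → ℝ),
      (lowPoly u * monicPoly v).degree < ((n + m : ℕ) : WithBot ℕ) := fun {n m} u v => by
    rw [(monic_monicPoly v).degree_mul, degree_eq_natDegree (monic_monicPoly v).ne_zero,
      natDegree_monicPoly, Nat.cast_add]
    rcases eq_or_ne (lowPoly u) 0 with h | h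
    · rw [h, degree_zero, WithBot.bot_add]; exact WithBot.bot_lt_coe _
    · have := degree_lowPoly_lt u
      rw [degree_eq_natDegree h] at this ⊢
      exact_mod_cast Nat.add_lt_add_right (by exact_mod_cast this) m
  have h0 : lowPoly w.1 * monicPoly z.2 + monicPoly z.1 * lowPoly w.2 = 0 := by
    have hlt : (lowPoly w.1 * monicPoly z.2 + monicPoly z.1 * lowPoly w.2).degree
        < ((p + q : ℕ) : WithBot ℕ) := by
      refine (degree_add_le _ _).trans_lt (max_lt (hdeg _ _) ?_)
      rw [mul_comm, add_comm p q]
      exact hdeg _ _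
    ext k
    by_cases hk : k < p + q
    · have := fderiv_mulCoeff_apply z w ⟨k, hk⟩
      rw [hw] at this
      simpa using this.symm
    · rw [coeff_zero]
      exact coeff_eq_zero_of_degree_lt (hlt.trans_le (by exact_mod_cast not_lt.1 hk))
  have h1 : lowPoly w.1 = 0 := by
    have hd : monicPoly z.1 ∣ lowPoly w.1 * monicPoly z.2 :=
      ⟨-lowPoly w.2, by linear_combination h0⟩
    refine eq_zero_of_dvd_of_degree_lt (hz.dvd_of_dvd_mul_right hd) ?_
    rw [degree_eq_natDegree (monic_monicPoly _).ne_zero, natDegree_monicPoly]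
    exact degree_lowPoly_lt _
  have h2 : lowPoly w.2 = 0 := by
    rw [h1, zero_mul, zero_add] at h0
    exact (mul_eq_zero.1 h0).resolve_left (monic_monicPoly _).ne_zero
  exact Prod.ext (lowPoly_eq_zero h1) (lowPoly_eq_zero h2)

/-- Hensel's lemma for analytic families of monic polynomials. -/
theorem exists_analyticAt_factor {p q : ℕ} {u₀ : Fin p → ℝ} {v₀ : Fin q → ℝ}
    (hcop : IsCoprime (monicPoly u₀) (monicPoly v₀)) {b : ℝ → Fin (p + q) → ℝ}
    (hb : AnalyticAt ℝ b 0) (h0 : monicPoly (b 0) = monicPoly u₀ * monicPoly v₀) :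
    ∃ (u : ℝ → Fin p → ℝ) (v : ℝ → Fin q → ℝ), AnalyticAt ℝ u 0 ∧ AnalyticAt ℝ v 0 ∧
      ∀ᶠ ε in 𝓝 0, monicPoly (b ε) = monicPoly (u ε) * monicPoly (v ε) := by
  set z : (Fin p → ℝ) × (Fin q → ℝ) := (u₀, v₀)
  have hz : mulCoeff z = b 0 := monicPoly_injective (by rw [monicPoly_mulCoeff, h0])
  -- Source and target both have dimension `p + q`, so injectivity makes the derivative invertible
  -- and the analytic inverse function theorem applies.
  set L := ((fderiv ℝ (mulCoeff (p := p) (q := q)) z).toLinearMap.linearEquivOfInjective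
    (fderiv_mulCoeff_injective hcop) (by simp)).toContinuousLinearEquiv
  have hL : HasFDerivAt (mulCoeff (p := p) (q := q)) (L : _ →L[ℝ] _) z := by
    have hLe : (L : _ →L[ℝ] _) = fderiv ℝ (mulCoeff (p := p) (q := q)) z :=
      ContinuousLinearMap.ext fun w => rfl
    rw [hLe]
    exact (analyticAt_mulCoeff z).differentiableAt.hasFDerivAt
  have hc : ContDiffAt ℝ ⊤ (mulCoeff (p := p) (q := q)) z := (analyticAt_mulCoeff z).contDiffAt
  have hinv := (hc.to_localInverse hL (by simp)).analyticAt
  have hright := (hc.hasStrictFDerivAt' hL (by simp)).eventually_right_inverse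
  rw [hz] at hinv hright
  have hcomp := hinv.comp hb
  refine ⟨fun ε => (hc.localInverse hL (by simp) (b ε)).1,
    fun ε => (hc.localInverse hL (by simp) (b ε)).2, analyticAt_fst.comp hcomp,
    analyticAt_snd.comp hcomp, ?_⟩
  filter_upwards [hb.continuousAt.eventually hright] with ε hε
  rw [← monicPoly_mulCoeff]
  exact congrArg monicPoly hε.symm

/-! ### Orders of vanishing and real-rooted polynomials -/

/-- If the order were `k < m`, the nonvanishing cofactor would be `O(ε^(m-k))` and so tend to `0`
along `l`. The filter is general so that a bound on one side of `0` suffices. -/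
lemma AnalyticAt.exists_eq_pow_mul_of_isBigO {f : ℝ → ℝ} (hf : AnalyticAt ℝ f 0) {l : Filter ℝ}
    [l.NeBot] (hl : l ≤ 𝓝[≠] 0) {m : ℕ} (hO : f =O[l] fun ε => ε ^ m) :
    ∃ g : ℝ → ℝ, AnalyticAt ℝ g 0 ∧ ∀ᶠ ε in 𝓝 0, f ε = ε ^ m * g ε := by
  suffices h : (m : ℕ∞) ≤ analyticOrderAt f 0 by
    simpa using (natCast_le_analyticOrderAt hf).1 h
  by_contra! hlt
  obtain ⟨k, hk⟩ := ENat.ne_top_iff_exists.1 hlt.ne_top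
  obtain ⟨g, hg, hg0, hfg⟩ := (hf.analyticOrderAt_eq_natCast).1 hk.symm
  rw [← hk] at hlt
  have hkm : k < m := by exact_mod_cast hlt
  have hl0 : l ≤ 𝓝 0 := hl.trans nhdsWithin_le_nhds
  have hgO : g =O[l] fun ε : ℝ => ε ^ (m - k) := by
    obtain ⟨C, hC⟩ := hO.bound
    refine Asymptotics.IsBigO.of_bound C ?_
    filter_upwards [hC, hl0 hfg, hl self_mem_nhdsWithin] with ε h1 h2 (h3 : ε ≠ 0)
    rw [h2, sub_zero, smul_eq_mul, norm_mul, ← Nat.sub_add_cancel hkm.le, pow_add, norm_mul] at h1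
    have hpos : 0 < ‖ε ^ k‖ := norm_pos_iff.2 (pow_ne_zero _ h3)
    nlinarith
  have hlim : Tendsto (fun ε : ℝ => ε ^ (m - k)) l (𝓝 0) := by
    have : Tendsto (fun ε : ℝ => ε ^ (m - k)) (𝓝 0) (𝓝 (0 ^ (m - k))) :=
      (continuous_pow (m - k)).tendsto 0
    rw [zero_pow (by omega)] at this
    exact this.mono_left hl0
  exact hg0 (tendsto_nhds_unique (hg.continuousAt.tendsto.mono_left hl0) (hgO.trans_tendsto hlim))

lemma Multiset.sum_sq_eq (s : Multiset ℝ) :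
    (s.map (· ^ 2)).sum = s.esymm 1 ^ 2 - 2 * s.esymm 2 := by
  have h1 : ∀ s : Multiset ℝ, s.esymm 1 = s.sum := fun s => by
    simp [Multiset.esymm, Multiset.powersetCard_one, Multiset.map_map]
  induction s using Multiset.induction with
  | empty =>
    rw [h1]
    simp [Multiset.esymm, Multiset.powersetCard_zero_right 1]
  | cons a s ih =>
    have h2 : (a ::ₘ s).esymm 2 = s.esymm 2 + a * s.sum := by
      rw [← h1]
      simp [Multiset.esymm, Multiset.powersetCard_cons, Multiset.map_map, Multiset.sum_map_mul_left]
    rw [h1] at ih ⊢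
    rw [h2, Multiset.map_cons, Multiset.sum_cons, ih, Multiset.sum_cons]
    ring

/-- Newton's identity. When the roots are centred, the coefficient of degree `n - 2` alone controls
all of them, since they are real. -/
lemma Polynomial.Splits.sum_sq_roots {P : ℝ[X]} (hs : P.Splits) (hm : P.Monic)
    (hn : 2 ≤ P.natDegree) :
    (P.roots.map (· ^ 2)).sum =
      P.coeff (P.natDegree - 1) ^ 2 - 2 * P.coeff (P.natDegree - 2) := by
  rw [Multiset.sum_sq_eq, coeff_eq_esymm_roots_of_splits hs (by omega),
    coeff_eq_esymm_roots_of_splits hs (by omega), hm.leadingCoeff,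
    show P.natDegree - (P.natDegree - 1) = 1 by omega,
    show P.natDegree - (P.natDegree - 2) = 2 by omega]
  ring

/-- Each real root `a` satisfies `|Im z| ≤ |z - a|`. The inequality survives limits of coefficients,
which makes real-rootedness a closed condition. -/
lemma abs_im_pow_le_norm_eval {P : ℝ[X]} (hs : P.Splits) (hm : P.Monic) (z : ℂ) :
    |z.im| ^ P.natDegree ≤ ‖aeval z P‖ := by
  rw [(hs.map (algebraMap ℝ ℂ)).aeval_eq_prod_aroots_of_monic hm, hs.natDegree_eq_card_roots,
    aroots, hs.roots_map, Multiset.map_map]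
  induction P.roots using Multiset.induction with
  | empty => simp
  | cons a s ih =>
    rw [Multiset.card_cons, pow_succ', Multiset.map_cons, Multiset.prod_cons, norm_mul]
    refine mul_le_mul ?_ ih (by positivity) (norm_nonneg _)
    simpa using Complex.abs_im_le_norm (z - a)

lemma splits_monicPoly_of_tendsto {n : ℕ} {b : ℝ → Fin n → ℝ} (hb : ContinuousAt b 0)
    (hs : ∀ᶠ ε in 𝓝[≠] 0, (monicPoly (b ε)).Splits) : (monicPoly (b 0)).Splits := by
  refine Splits.of_splits_map (algebraMap ℝ ℂ) (IsAlgClosed.splits _) fun z hz => ?_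
  have hz0 : aeval z (monicPoly (b 0)) = 0 := by
    rw [mem_roots (by simpa using (monic_monicPoly _).ne_zero), IsRoot, eval_map_algebraMap] at hz
    exact hz
  have hcont : ContinuousAt (fun ε => ‖aeval z (monicPoly (b ε))‖) 0 := by
    simp only [monicPoly, map_add, map_pow, aeval_X, map_sum, map_mul, aeval_C]
    refine (continuousAt_const.add (tendsto_finsetSum _ fun i _ => ?_)).norm
    exact ((Complex.continuous_ofReal.continuousAt (x := b 0 i)).comp
      (f := fun ε => b ε i) (continuousAt_pi.1 hb i)).mul continuousAt_const
  have hle : |z.im| ^ n ≤ ‖aeval z (monicPoly (b 0))‖ := by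
    refine ge_of_tendsto (hcont.tendsto.mono_left (nhdsWithin_le_nhds (s := {0}ᶜ))) ?_
    filter_upwards [hs] with ε hε
    simpa [natDegree_monicPoly] using abs_im_pow_le_norm_eval hε (monic_monicPoly _) z
  rw [hz0, norm_zero] at hle
  have him : z.im = 0 := by
    by_contra h
    exact (pow_pos (abs_pos.2 h) n).not_ge hle
  exact ⟨z.re, Complex.ext (by simp) (by simp [him])⟩

/-- The polynomial cannot be `(X - ρ)^n`: a zero root sum would give `ρ = 0`, hence a zero
coefficient in degree `n - 2`. Removing one root with its full multiplicity thus leaves a nontrivial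
coprime cofactor. -/
lemma exists_coprime_factors {n : ℕ} {P : ℝ[X]} (hm : P.Monic) (hn : P.natDegree = n)
    (h2 : 2 ≤ n) (hs : P.Splits) (h1 : P.coeff (n - 1) = 0) (h0 : P.coeff (n - 2) ≠ 0) :
    ∃ (p q : ℕ) (u : Fin p → ℝ) (v : Fin q → ℝ), p < n ∧ q < n ∧ n = p + q ∧
      IsCoprime (monicPoly u) (monicPoly v) ∧ P = monicPoly u * monicPoly v := by
  obtain ⟨ρ, hρ⟩ := hs.exists_eval_eq_zero (by
    rw [degree_eq_natDegree hm.ne_zero, hn]; exact_mod_cast (by omega : n ≠ 0))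
  obtain ⟨G, hG, hnd⟩ := exists_eq_pow_rootMultiplicity_mul_and_not_dvd P hm.ne_zero ρ
  have hj : 0 < P.rootMultiplicity ρ := (rootMultiplicity_pos hm.ne_zero).2 hρ
  set j := P.rootMultiplicity ρ
  have hXm : ((X - C ρ) ^ j).Monic := (monic_X_sub_C ρ).pow j
  have hGm : G.Monic := hXm.of_mul_monic_left (hG ▸ hm)
  have hXd : ((X - C ρ) ^ j).natDegree = j := by
    rw [(monic_X_sub_C ρ).natDegree_pow, natDegree_X_sub_C, mul_one]
  have hsum : n = j + G.natDegree := by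
    rw [← hn, ← hXd, ← hXm.natDegree_mul hGm, ← hG]
  have hGd : G.natDegree ≠ 0 := by
    intro hd
    have hG1 : G = 1 := hGm.natDegree_eq_zero.1 hd
    have hjn : j = n := by omega
    rw [hG1, mul_one, hjn, sub_eq_add_neg, ← C_neg] at hG
    have hρ0 : ρ = 0 := by
      rw [hG, coeff_X_add_C_pow, show n - (n - 1) = 1 by omega] at h1
      have : ((n.choose (n - 1) : ℕ) : ℝ) ≠ 0 :=
        Nat.cast_ne_zero.2 (Nat.choose_pos (by omega)).ne'
      simpa [this] using h1
    apply h0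
    rw [hG, hρ0, neg_zero, C_0, add_zero, coeff_X_pow, if_neg (by omega)]
  have e1 := eq_monicPoly hXm hXd
  have e2 := eq_monicPoly hGm rfl
  refine ⟨j, G.natDegree, fun i => ((X - C ρ) ^ j).coeff i, fun i => G.coeff i, by omega, by omega,
    hsum, ?_, ?_⟩
  · rw [← e1, ← e2]
    exact (((irreducible_X_sub_C ρ).coprime_iff_not_dvd).2 hnd).pow_left
  · rw [← e1, ← e2, ← hG]

/-! ### Analytic roots of real-rooted families -/

/-- The family of monic polynomials with coefficients `b ε` has analytic roots near `0`. -/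
def HasAnalyticRoots {n : ℕ} (b : ℝ → Fin n → ℝ) : Prop :=
  ∃ S : Multiset (ℝ → ℝ), (∀ r ∈ S, AnalyticAt ℝ r 0) ∧
    ∀ᶠ ε in 𝓝 0, monicPoly (b ε) = (S.map fun r => X - C (r ε)).prod

/-- An odd power would change sign across `0` while `g` does not; the hypothesis is needed on both
sides of `0`. -/
lemma even_of_pow_mul_nonneg {g : ℝ → ℝ} (hg : ContinuousAt g 0) (h0 : g 0 ≠ 0) {j : ℕ}
    (h : ∀ᶠ ε in 𝓝 0, 0 ≤ ε ^ j * g ε) : Even j := by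
  by_contra hj
  rw [Nat.not_even_iff_odd] at hj
  rcases h0.lt_or_gt with h0 | h0
  · have h1 : ∀ᶠ ε in 𝓝[>] (0 : ℝ), False := by
      filter_upwards [nhdsWithin_le_nhds h, nhdsWithin_le_nhds (hg.eventually_lt_const h0),
        self_mem_nhdsWithin] with ε h1 h2 (h3 : 0 < ε)
      exact (mul_neg_of_pos_of_neg (pow_pos h3 j) h2).not_ge h1
    exact h1.exists.choose_spec
  · have h1 : ∀ᶠ ε in 𝓝[<] (0 : ℝ), False := by
      filter_upwards [nhdsWithin_le_nhds h, nhdsWithin_le_nhds (hg.eventually_const_lt h0),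
        self_mem_nhdsWithin] with ε h1 h2 (h3 : ε < 0)
      exact (mul_neg_of_neg_of_pos (hj.pow_neg h3) h2).not_ge h1
    exact h1.exists.choose_spec

lemma scaleRoots_prod_X_sub_C (S : Multiset (ℝ → ℝ)) (ε s : ℝ) :
    ((S.map fun r => (X - C (r ε) : ℝ[X])).prod).scaleRoots s =
      (S.map fun r => (X - C (r ε * s) : ℝ[X])).prod := by
  induction S using Multiset.induction with
  | empty => simp [one_scaleRoots]
  | cons a S ih =>
    simp only [Multiset.map_cons, Multiset.prod_cons, mul_scaleRoots_of_noZeroDivisors,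
      X_sub_C_scaleRoots, ih]

lemma HasAnalyticRoots.scale {n : ℕ} {b b' : ℝ → Fin n → ℝ} (h : HasAnalyticRoots b') {k : ℕ}
    (hb : ∀ᶠ ε in 𝓝 0, monicPoly (b ε) = (monicPoly (b' ε)).scaleRoots (ε ^ k)) :
    HasAnalyticRoots b := by
  obtain ⟨S, hS, hb'⟩ := h
  refine ⟨S.map fun r => fun ε => r ε * ε ^ k, ?_, ?_⟩
  · intro r hr
    obtain ⟨r', hr', rfl⟩ := Multiset.mem_map.1 hr
    exact (hS r' hr').mul (analyticAt_id.pow k)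
  · filter_upwards [hb, hb'] with ε h1 h2
    rw [h1, h2, scaleRoots_prod_X_sub_C, Multiset.map_map]
    rfl

lemma abs_coeff_monicPoly_le {n : ℕ} {u : Fin n → ℝ} (hs : (monicPoly u).Splits) {R : ℝ}
    (hR : ∀ r ∈ (monicPoly u).roots, |r| ≤ R) (i : Fin n) :
    |u i| ≤ R ^ (n - i) * n.choose i := by
  have := coeff_le_of_roots_le (f := RingHom.id ℝ) (p := monicPoly u) (B := R) (i : ℕ)
    (monic_monicPoly u) (by simpa using hs) (by simpa using hR)
  simpa [natDegree_monicPoly, coeff_monicPoly_fin] using this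

/-- A centred analytic family of real-rooted polynomials is obtained by scaling
the roots of an analytic family which does not collapse at `0`. -/
lemma exists_scaled_family {n : ℕ} (h2 : 2 ≤ n) {b : ℝ → Fin n → ℝ} (hb : AnalyticAt ℝ b 0)
    (hs : ∀ᶠ ε in 𝓝 0, (monicPoly (b ε)).Splits)
    (hc : ∀ᶠ ε in 𝓝 0, (monicPoly (b ε)).coeff (n - 1) = 0)
    (hne : ¬ ∀ᶠ ε in 𝓝 0, (monicPoly (b ε)).coeff (n - 2) = 0) :
    ∃ (k : ℕ) (b' : ℝ → Fin n → ℝ), AnalyticAt ℝ b' 0 ∧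
      (∀ᶠ ε in 𝓝 0, monicPoly (b ε) = (monicPoly (b' ε)).scaleRoots (ε ^ k)) ∧
      (monicPoly (b' 0)).coeff (n - 2) ≠ 0 := by
  have hN := analyticAt_coeff_monicPoly hb (n - 2)
  have hsum : ∀ᶠ ε in 𝓝 0, ((monicPoly (b ε)).roots.map (· ^ 2)).sum =
      -2 * (monicPoly (b ε)).coeff (n - 2) := by
    filter_upwards [hs, hc] with ε h1 h3
    have := h1.sum_sq_roots (monic_monicPoly _) (by rwa [natDegree_monicPoly])
    rw [natDegree_monicPoly, h3] at this
    rw [this]; ring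
  obtain ⟨j, hj⟩ := ENat.ne_top_iff_exists.1 fun h => hne (analyticOrderAt_eq_top.1 h)
  obtain ⟨g, hg, hg0, hfg⟩ := (hN.analyticOrderAt_eq_natCast).1 hj.symm
  simp only [sub_zero, smul_eq_mul] at hfg
  -- The sum of squares of the roots is nonnegative and vanishes to order `j`, so `j = 2k` and every
  -- root is `O(ε^k)`.
  obtain ⟨k, rfl⟩ : Even j := by
    refine even_of_pow_mul_nonneg (g := fun ε => -2 * g ε) (continuousAt_const.mul hg.continuousAt)
      (by simpa using hg0) ?_
    filter_upwards [hsum, hfg] with ε h1 h3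
    have : 0 ≤ ((monicPoly (b ε)).roots.map (· ^ 2)).sum :=
      Multiset.sum_nonneg fun x hx => by
        obtain ⟨y, -, rfl⟩ := Multiset.mem_map.1 hx; positivity
    rw [h1, h3] at this
    linarith
  -- The added `1` gives `M ≤ M * M`, so `M` bounds the roots without a square root.
  set M : ℝ := |(-2) * g 0| + 1
  have hroots : ∀ᶠ ε in 𝓝 0, ∀ r ∈ (monicPoly (b ε)).roots, |r| ≤ M * |ε| ^ k := by
    have hM : ∀ᶠ ε in 𝓝 0, |(-2) * g ε| < M :=
      ((continuousAt_const.mul hg.continuousAt).abs).eventually_lt_const (lt_add_one _)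
    filter_upwards [hsum, hfg, hM] with ε h1 h3 h4 r hr
    have hM1 : 1 ≤ M := le_add_of_nonneg_left (abs_nonneg _)
    refine abs_le_of_sq_le_sq ?_ (by positivity)
    calc r ^ 2 ≤ ((monicPoly (b ε)).roots.map (· ^ 2)).sum :=
          Multiset.single_le_sum (fun x hx => by
            obtain ⟨y, -, rfl⟩ := Multiset.mem_map.1 hx; positivity) _
            (Multiset.mem_map_of_mem _ hr)
      _ = (|ε| ^ k) ^ 2 * (-2 * g ε) := by
          rw [h1, h3, ← pow_mul, mul_comm k 2, pow_mul, sq_abs, ← pow_mul, two_mul k]; ring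
      _ ≤ (|ε| ^ k) ^ 2 * M := by
          gcongr; exact (le_abs_self _).trans h4.le
      _ ≤ (|ε| ^ k) ^ 2 * (M * M) := by
          gcongr; nlinarith
      _ = (M * |ε| ^ k) ^ 2 := by ring
  have hO : ∀ i : Fin n, (fun ε => b ε i) =O[𝓝[≠] 0] fun ε : ℝ => ε ^ (k * (n - i)) := fun i => by
    refine Asymptotics.IsBigO.of_bound (M ^ (n - (i : ℕ)) * n.choose i) ?_
    filter_upwards [nhdsWithin_le_nhds hs, nhdsWithin_le_nhds hroots] with ε h1 h3
    refine (abs_coeff_monicPoly_le h1 h3 i).trans (le_of_eq ?_)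
    rw [Real.norm_eq_abs, abs_pow, mul_pow, ← pow_mul]
    ring
  choose c hca hcb using fun i =>
    (analyticAt_pi_iff.1 hb i).exists_eq_pow_mul_of_isBigO le_rfl (hO i)
  have hscale : ∀ᶠ ε in 𝓝 0,
      monicPoly (b ε) = (monicPoly fun i => c i ε).scaleRoots (ε ^ k) := by
    filter_upwards [eventually_all.2 hcb] with ε h1
    ext i
    rw [coeff_scaleRoots, natDegree_monicPoly, coeff_monicPoly, coeff_monicPoly]
    rcases lt_trichotomy i n with h | h | h
    · simp only [h, h.ne, dif_pos, if_false, zero_add]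
      rw [h1, ← pow_mul]
      exact mul_comm _ _
    · simp [h]
    · simp [h.ne', h.not_gt]
  refine ⟨k, fun ε i => c i ε, analyticAt_pi_iff.2 hca, hscale, ?_⟩
  have hcg : ContinuousAt (fun ε => (monicPoly fun i => c i ε).coeff (n - 2)) 0 :=
    (analyticAt_coeff_monicPoly (analyticAt_pi_iff.2 hca) _).continuousAt
  -- Dividing the roots by `ε^k` divides this coefficient by `ε^(2k)`, which leaves exactly the
  -- nonvanishing cofactor `g`.
  have heq : ∀ᶠ ε in 𝓝[≠] 0, (monicPoly fun i => c i ε).coeff (n - 2) = g ε := by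
    filter_upwards [nhdsWithin_le_nhds hscale, nhdsWithin_le_nhds hfg, self_mem_nhdsWithin]
      with ε h1 h3 (h4 : ε ≠ 0)
    rw [h1, coeff_scaleRoots, natDegree_monicPoly, ← pow_mul,
      show k * (n - (n - 2)) = k + k by rw [show n - (n - 2) = 2 by omega]; ring, mul_comm] at h3
    exact mul_left_cancel₀ (pow_ne_zero _ h4) h3
  have := tendsto_nhds_unique_of_eventuallyEq (hcg.tendsto.mono_left nhdsWithin_le_nhds)
    (hg.continuousAt.tendsto.mono_left (nhdsWithin_le_nhds (s := {0}ᶜ))) heq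
  rwa [this]

/-- If the coefficient of degree `n - 2` vanishes identically, all roots are zero. Otherwise, after
scaling, the limit polynomial has two distinct real roots, so Hensel's lemma splits the family into
factors of smaller degree. -/
lemma hasAnalyticRoots_of_centred {n : ℕ} (h2 : 2 ≤ n)
    (ih : ∀ m < n, ∀ b : ℝ → Fin m → ℝ, AnalyticAt ℝ b 0 →
      (∀ᶠ ε in 𝓝 0, (monicPoly (b ε)).Splits) → HasAnalyticRoots b)
    {b : ℝ → Fin n → ℝ} (hb : AnalyticAt ℝ b 0)
    (hs : ∀ᶠ ε in 𝓝 0, (monicPoly (b ε)).Splits)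
    (hc : ∀ᶠ ε in 𝓝 0, (monicPoly (b ε)).coeff (n - 1) = 0) : HasAnalyticRoots b := by
  by_cases hz : ∀ᶠ ε in 𝓝 0, (monicPoly (b ε)).coeff (n - 2) = 0
  · refine ⟨Multiset.replicate n 0, fun r hr => ?_, ?_⟩
    · rw [Multiset.eq_of_mem_replicate hr]; exact analyticAt_const
    · filter_upwards [hs, hc, hz] with ε h1 h3 h4
      have hsq := h1.sum_sq_roots (monic_monicPoly _) (by rwa [natDegree_monicPoly])
      rw [natDegree_monicPoly, h3, h4] at hsq
      have hr : (monicPoly (b ε)).roots = Multiset.replicate n 0 := by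
        refine Multiset.eq_replicate.2 ⟨by
          rw [← h1.natDegree_eq_card_roots, natDegree_monicPoly], fun r hr => ?_⟩
        have : r ^ 2 ≤ 0 := by
          refine (Multiset.single_le_sum (fun x hx => ?_) _
            (Multiset.mem_map_of_mem (· ^ 2) hr)).trans_eq (hsq.trans (by ring))
          obtain ⟨y, -, rfl⟩ := Multiset.mem_map.1 hx; positivity
        nlinarith
      rw [h1.eq_prod_roots_of_monic (monic_monicPoly _), hr]
      simp
  · obtain ⟨k, b', hb', hscale, h0⟩ := exists_scaled_family h2 hb hs hc hz
    refine HasAnalyticRoots.scale ?_ hscale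
    have hs' : ∀ᶠ ε in 𝓝[≠] 0, (monicPoly (b' ε)).Splits := by
      filter_upwards [nhdsWithin_le_nhds hs, nhdsWithin_le_nhds hscale, self_mem_nhdsWithin]
        with ε h1 h3 (h4 : ε ≠ 0)
      have := h1.scaleRoots (ε ^ k)⁻¹
      rwa [h3, ← scaleRoots_mul, mul_inv_cancel₀ (pow_ne_zero _ h4), scaleRoots_one] at this
    -- At `ε = 0` scaling by `ε^k` may lose information, so real-rootedness there is obtained as a
    -- limit.
    have hs0 := splits_monicPoly_of_tendsto hb'.continuousAt hs'
    have hc0 : (monicPoly (b' 0)).coeff (n - 1) = 0 := by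
      refine tendsto_nhds_unique_of_eventuallyEq
        ((analyticAt_coeff_monicPoly hb' (n - 1)).continuousAt.tendsto.mono_left
          (nhdsWithin_le_nhds (s := {0}ᶜ))) tendsto_const_nhds ?_
      filter_upwards [nhdsWithin_le_nhds hc, nhdsWithin_le_nhds hscale, self_mem_nhdsWithin]
        with ε h1 h3 (h4 : ε ≠ 0)
      rw [h3, coeff_scaleRoots] at h1
      exact (mul_eq_zero.1 h1).resolve_right (pow_ne_zero _ (pow_ne_zero _ h4))
    obtain ⟨p, q, u, v, hp, hq, rfl, hcop, hfac⟩ := exists_coprime_factors (monic_monicPoly _)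
      (natDegree_monicPoly _) h2 hs0 hc0 h0
    obtain ⟨u', v', hu', hv', huv⟩ := exists_analyticAt_factor hcop hb' hfac
    have hsall : ∀ᶠ ε in 𝓝 0, (monicPoly (b' ε)).Splits := by
      rw [← nhdsNE_sup_pure]
      exact eventually_sup.2 ⟨hs', hs0⟩
    obtain ⟨S, hS, hSu⟩ := ih p hp u' hu' (by
      filter_upwards [huv, hsall] with ε h1 h3
      exact h3.of_dvd (monic_monicPoly _).ne_zero ⟨_, h1⟩)
    obtain ⟨T, hT, hTv⟩ := ih q hq v' hv' (by
      filter_upwards [huv, hsall] with ε h1 h3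
      exact h3.of_dvd (monic_monicPoly _).ne_zero ⟨_, h1.trans (mul_comm _ _)⟩)
    refine ⟨S + T, fun r hr => (Multiset.mem_add.1 hr).elim (hS r) (hT r), ?_⟩
    filter_upwards [huv, hSu, hTv] with ε h1 h3 h4
    rw [h1, h3, h4, Multiset.map_add, Multiset.prod_add]

lemma analyticAt_coeff_taylor {n : ℕ} {b : ℝ → Fin n → ℝ} (hb : AnalyticAt ℝ b 0) {c : ℝ → ℝ}
    (hc : AnalyticAt ℝ c 0) (k : ℕ) :
    AnalyticAt ℝ (fun ε => (taylor (c ε) (monicPoly (b ε))).coeff k) 0 := by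
  simp only [monicPoly, map_add, taylor_pow, taylor_X, map_sum, taylor_mul, taylor_C, coeff_add,
    finsetSum_coeff, coeff_C_mul, coeff_X_add_C_pow]
  refine ((hc.pow _).mul analyticAt_const).add (Finset.analyticAt_fun_sum _ fun i _ => ?_)
  exact (analyticAt_pi_iff.1 hb i).mul ((hc.pow _).mul analyticAt_const)

lemma coeff_pred_taylor_monicPoly {n : ℕ} (hn : 0 < n) (u : Fin n → ℝ) (c : ℝ) :
    (taylor c (monicPoly u)).coeff (n - 1) = n * c + u ⟨n - 1, by omega⟩ := by
  simp only [monicPoly, map_add, taylor_pow, taylor_X, map_sum, taylor_mul, taylor_C, coeff_add,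
    finsetSum_coeff, coeff_C_mul, coeff_X_add_C_pow]
  rw [Finset.sum_eq_single ⟨n - 1, by omega⟩]
  · rw [show n - (n - 1) = 1 by omega, ← Nat.choose_symm (Nat.sub_le n 1),
      show n - (n - 1) = 1 by omega]
    simp [mul_comm]
  · intro i _ hi
    have : (i : ℕ) < n - 1 := by
      have : (i : ℕ) ≠ n - 1 := fun h => hi (Fin.ext h)
      omega
    simp [Nat.choose_eq_zero_of_lt this]
  · simp

/-- **Rellich's theorem** for monic polynomials: an analytic one-parameter family of real-rooted
monic polynomials has analytic roots. -/
theorem hasAnalyticRoots_of_splits (n : ℕ) : ∀ b : ℝ → Fin n → ℝ, AnalyticAt ℝ b 0 →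
    (∀ᶠ ε in 𝓝 0, (monicPoly (b ε)).Splits) → HasAnalyticRoots b := by
  induction n using Nat.strong_induction_on with
  | _ n ih =>
  intro b hb hs
  rcases Nat.lt_or_ge n 2 with hn | hn
  · interval_cases n
    · exact ⟨0, by simp, Eventually.of_forall fun ε => by simp [monicPoly]⟩
    · refine ⟨{fun ε => -b ε 0}, ?_, Eventually.of_forall fun ε => by simp [monicPoly]⟩
      intro r hr
      rw [Multiset.mem_singleton.1 hr]
      exact (analyticAt_pi_iff.1 hb 0).neg
  -- Translation by the mean of the roots kills the coefficient of degree `n - 1`.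
  · set c : ℝ → ℝ := fun ε => -(b ε ⟨n - 1, by omega⟩ / n)
    have hc : AnalyticAt ℝ c 0 := (analyticAt_pi_iff.1 hb _).div_const.neg
    set d : ℝ → Fin n → ℝ := fun ε i => (taylor (c ε) (monicPoly (b ε))).coeff i
    have hd : AnalyticAt ℝ d 0 := analyticAt_pi_iff.2 fun i => analyticAt_coeff_taylor hb hc i
    have hdb : ∀ ε, monicPoly (d ε) = taylor (c ε) (monicPoly (b ε)) := fun ε =>
      (eq_monicPoly ((leadingCoeff_taylor _ _).trans (monic_monicPoly _)) (by
        rw [natDegree_taylor, natDegree_monicPoly])).symm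
    obtain ⟨S, hS, hSd⟩ := hasAnalyticRoots_of_centred hn ih hd
      (hs.mono fun ε h => by rw [hdb]; exact h.taylor _)
      (Eventually.of_forall fun ε => by
        rw [hdb, coeff_pred_taylor_monicPoly (by omega)]
        have : (n : ℝ) ≠ 0 := by positivity
        simp only [c]; field_simp; ring)
    refine ⟨S.map fun r => fun ε => r ε + c ε, fun r hr => ?_, ?_⟩
    · obtain ⟨r', hr', rfl⟩ := Multiset.mem_map.1 hr
      exact (hS r' hr').add hc
    · filter_upwards [hSd] with ε h
      rw [hdb] at h
      have h' := congrArg (taylor (-c ε)) h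
      rw [taylor_taylor, neg_add_cancel, taylor_zero] at h'
      rw [h', ← taylorAlgHom_apply, map_multiset_prod, Multiset.map_map, Multiset.map_map]
      congr 1
      refine Multiset.map_congr rfl fun r _ => ?_
      simp
      ring

/-! ### Analyticity of sorted eigenvalues on the right of zero -/

/-- To the right of `0`, an analytic germ is identically zero or has the constant sign of its
leading coefficient. -/
lemma AnalyticAt.eventually_nonneg_of_frequently {h : ℝ → ℝ} (hh : AnalyticAt ℝ h 0)
    (hf : ∃ᶠ ε in 𝓝[>] (0 : ℝ), 0 ≤ h ε) : ∀ᶠ ε in 𝓝[>] (0 : ℝ), 0 ≤ h ε := by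
  by_cases ht : analyticOrderAt h 0 = ⊤
  · filter_upwards [nhdsWithin_le_nhds (analyticOrderAt_eq_top.1 ht)] with ε hε
    exact hε.ge
  · obtain ⟨k, hk⟩ := ENat.ne_top_iff_exists.1 ht
    obtain ⟨g, hg, hg0, hfg⟩ := (hh.analyticOrderAt_eq_natCast).1 hk.symm
    simp only [sub_zero, smul_eq_mul] at hfg
    rcases hg0.lt_or_gt with h0 | h0
    · refine absurd hf (not_frequently.2 ?_)
      filter_upwards [nhdsWithin_le_nhds hfg,
        nhdsWithin_le_nhds (hg.continuousAt.eventually_lt_const h0), self_mem_nhdsWithin]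
        with ε h1 h2 (h3 : 0 < ε)
      rw [h1]
      exact (mul_neg_of_pos_of_neg (pow_pos h3 k) h2).not_ge
    · filter_upwards [nhdsWithin_le_nhds hfg,
        nhdsWithin_le_nhds (hg.continuousAt.eventually_const_lt h0), self_mem_nhdsWithin]
        with ε h1 h2 (h3 : 0 < ε)
      rw [h1]
      exact (mul_pos (pow_pos h3 k) h2).le

/-- There are finitely many permutations, so one of them sorts the values for arbitrarily small `ε >
0`; constancy of sign of the differences then makes it sort them for all small `ε > 0`, and
continuity adds `ε = 0`. -/
lemma exists_perm_eventually_antitone {n : ℕ} {r : Fin n → ℝ → ℝ}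
    (hr : ∀ i, AnalyticAt ℝ (r i) 0) :
    ∃ σ : Equiv.Perm (Fin n), ∀ᶠ ε in 𝓝[≥] (0 : ℝ), Antitone fun s => r (σ s) ε := by
  have hex : ∃ᶠ ε in 𝓝[>] (0 : ℝ), ∃ σ : Equiv.Perm (Fin n), Antitone fun s => r (σ s) ε := by
    refine (Eventually.of_forall fun ε => ?_).frequently
    refine ⟨Tuple.sort fun i => -r i ε, fun s t hst => ?_⟩
    simpa using Tuple.monotone_sort (fun i => -r i ε) hst
  obtain ⟨σ, hσ⟩ : ∃ σ : Equiv.Perm (Fin n), ∃ᶠ ε in 𝓝[>] (0 : ℝ),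
      Antitone fun s => r (σ s) ε := by
    by_contra! hcon
    refine hex ?_
    filter_upwards [eventually_all.2 hcon] with ε h
    simpa using h
  refine ⟨σ, ?_⟩
  have hpos : ∀ᶠ ε in 𝓝[>] (0 : ℝ), ∀ s t : Fin n, s ≤ t → 0 ≤ r (σ s) ε - r (σ t) ε := by
    refine eventually_all.2 fun s => eventually_all.2 fun t => ?_
    by_cases hst : s ≤ t
    · simp only [hst, true_imp_iff]
      refine AnalyticAt.eventually_nonneg_of_frequently ((hr _).sub (hr _)) (hσ.mono fun ε h => ?_)
      exact sub_nonneg.2 (h hst)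
    · simp [hst]
  have h0 : ∀ s t : Fin n, s ≤ t → 0 ≤ r (σ s) 0 - r (σ t) 0 := fun s t hst => by
    refine ge_of_tendsto
      (((hr (σ s)).sub (hr (σ t))).continuousAt.tendsto.mono_left
        (nhdsWithin_le_nhds (s := Set.Ioi 0))) ?_
    filter_upwards [hpos] with ε h using h s t hst
  rw [← Set.Ioi_insert, nhdsWithin_insert]
  refine eventually_sup.2 ⟨?_, ?_⟩
  · exact fun s t hst => sub_nonneg.1 (h0 s t hst)
  · filter_upwards [hpos] with ε h s t hst using sub_nonneg.1 (h s t hst)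

lemma Antitone.eq_of_map_univ_eq {n : ℕ} {f g : Fin n → ℝ} (hf : Antitone f) (hg : Antitone g)
    (h : Finset.univ.val.map f = Finset.univ.val.map g) : f = g := by
  rw [Fin.univ_val_map, Fin.univ_val_map, Multiset.coe_eq_coe] at h
  exact List.ofFn_injective (h.eq_of_sortedGE hf.sortedGE_ofFn hg.sortedGE_ofFn)

lemma sortedEigenvalue_antitone {n : ℕ} (A : Matrix (Fin n) (Fin n) ℝ) :
    Antitone (sortedEigenvalue A) := by
  intro s t hst
  unfold sortedEigenvalue
  split_ifs with hA
  · exact hA.eigenvalues₀_antitone (show Fin.cast _ s ≤ Fin.cast _ t from hst)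
  · exact le_rfl

open scoped Classical in
lemma map_univ_sortedEigenvalue {n : ℕ} {A : Matrix (Fin n) (Fin n) ℝ} (hA : A.IsHermitian) :
    Finset.univ.val.map (sortedEigenvalue A) = A.charpoly.roots := by
  have h := hA.roots_charpoly_eq_eigenvalues₀
  have h1 : sortedEigenvalue A =
      hA.eigenvalues₀ ∘ finCongr (Fintype.card_fin n).symm := by
    ext s
    simp only [sortedEigenvalue, dif_pos hA, Function.comp]
    rfl
  convert h.symm using 1
  · rw [h1, ← Multiset.map_map, Multiset.map_univ_val_equiv]
    rfl

lemma charpoly_eq_prod_sortedEigenvalue {n : ℕ} {A : Matrix (Fin n) (Fin n) ℝ}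
    (hA : A.IsHermitian) : A.charpoly = ∏ s, (X - C (sortedEigenvalue A s)) := by
  rw [hA.splits_charpoly.eq_prod_roots_of_monic A.charpoly_monic, ← map_univ_sortedEigenvalue hA,
    Multiset.map_map]
  rfl

lemma analyticAt_coeff_charpoly {n : ℕ} {B : ℝ → Matrix (Fin n) (Fin n) ℝ}
    (hB : ∀ i j, AnalyticAt ℝ (fun ε => B ε i j) 0) (k : ℕ) :
    AnalyticAt ℝ (fun ε => (B ε).charpoly.coeff k) 0 := by
  have h : ∀ ε, (B ε).charpoly.coeff k =
      MvPolynomial.aeval (fun p : Fin n × Fin n => B ε p.1 p.2)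
        ((Matrix.charpoly.univ ℝ (Fin n)).coeff k) := fun ε => by
    have := Matrix.charpoly.univ_coeff_eval₂Hom (Fin n) (RingHom.id ℝ)
      (fun p : Fin n × Fin n => B ε p.1 p.2) k
    exact this.symm
  simp only [h]
  exact AnalyticAt.aeval_mvPolynomial (f := fun ε (p : Fin n × Fin n) => B ε p.1 p.2)
    (fun p => hB p.1 p.2) _

/-- **Rellich's theorem**, one-sided: the sorted eigenvalues of an analytic family of symmetric
matrices are analytic on the right of the base point. -/
theorem exists_analyticAt_sortedEigenvalue {n : ℕ} {A : ℝ → Matrix (Fin n) (Fin n) ℝ}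
    (hana : ∀ i j, AnalyticWithinAt ℝ (fun ε => A ε i j) (Set.Ici 0) 0)
    (hsym : ∀ᶠ ε in 𝓝[≥] (0 : ℝ), (A ε).IsHermitian) :
    ∃ g : Fin n → ℝ → ℝ, (∀ s, AnalyticAt ℝ (g s) 0) ∧
      ∀ᶠ ε in 𝓝[≥] (0 : ℝ), ∀ s, sortedEigenvalue (A ε) s = g s ε := by
  choose F _ hF hFa using fun i j => (hana i j).exists_analyticAt
  -- The analytic extensions of the entries come with no symmetry for `ε < 0`. Symmetrising keeps
  -- the values for small `ε ≥ 0` and makes the characteristic polynomial split on both sides of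
  -- `0`.
  set B : ℝ → Matrix (Fin n) (Fin n) ℝ := fun ε =>
    Matrix.of fun i j => (F i j ε + F j i ε) / 2
  have hBa : ∀ i j, AnalyticAt ℝ (fun ε => B ε i j) 0 := fun i j =>
    ((hFa i j).add (hFa j i)).div_const
  have hBh : ∀ ε, (B ε).IsHermitian := fun ε => by
    ext i j
    simp [B, add_comm]
  have hAB : ∀ᶠ ε in 𝓝[≥] (0 : ℝ), A ε = B ε := by
    filter_upwards [hsym, self_mem_nhdsWithin] with ε h1 h2
    ext i j
    have e1 : A ε i j = F i j ε := hF i j (Set.mem_insert_of_mem _ h2)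
    have e2 : A ε j i = F j i ε := hF j i (Set.mem_insert_of_mem _ h2)
    have e3 : A ε j i = A ε i j := by simpa using h1.apply i j
    simp only [B, Matrix.of_apply, ← e1, ← e2, e3]
    ring
  set b : ℝ → Fin n → ℝ := fun ε i => (B ε).charpoly.coeff i
  have hbB : ∀ ε, monicPoly (b ε) = (B ε).charpoly := fun ε =>
    (eq_monicPoly (B ε).charpoly_monic (by simp [Matrix.charpoly_natDegree_eq_dim])).symm
  obtain ⟨S, hS, hSb⟩ := hasAnalyticRoots_of_splits n b
    (analyticAt_pi_iff.2 fun i => analyticAt_coeff_charpoly hBa i)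
    (Eventually.of_forall fun ε => by rw [hbB]; exact (hBh ε).splits_charpoly)
  have hcard : S.card = n := by
    obtain ⟨ε, hε⟩ := hSb.exists
    have := congrArg natDegree hε
    rw [natDegree_monicPoly, natDegree_multiset_prod_of_monic] at this
    · simpa [Multiset.map_map, Function.comp_def] using this.symm
    · intro f hf
      obtain ⟨r, -, rfl⟩ := Multiset.mem_map.1 hf
      exact monic_X_sub_C _
  obtain ⟨L, rfl⟩ : ∃ L : List (ℝ → ℝ), (L : Multiset (ℝ → ℝ)) = S := Quot.exists_rep S
  obtain rfl : L.length = n := hcard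
  obtain ⟨σ, hσ⟩ := exists_perm_eventually_antitone (r := L.get)
    fun i => hS _ (List.get_mem L i)
  refine ⟨fun s => L.get (σ s), fun s => hS _ (List.get_mem L _), ?_⟩
  filter_upwards [hAB, hσ, nhdsWithin_le_nhds hSb] with ε h1 h2 h3
  rw [h1]
  refine congrFun (Antitone.eq_of_map_univ_eq (sortedEigenvalue_antitone _) h2 ?_)
  rw [map_univ_sortedEigenvalue (hBh ε), ← hbB, h3]
  have h4 : Multiset.map (fun r : ℝ → ℝ => (X - C (r ε) : ℝ[X])) (L : Multiset (ℝ → ℝ)) =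
      ((L : Multiset (ℝ → ℝ)).map fun r => r ε).map fun a => X - C a := by
    rw [Multiset.map_map]; rfl
  rw [h4, roots_multiset_prod_X_sub_C]
  have h5 : Multiset.map (fun s => L.get (σ s) ε) Finset.univ.val =
      (Finset.univ.val.map σ).map fun s => L.get s ε := by
    rw [Multiset.map_map]; rfl
  rw [h5, Multiset.map_univ_val_equiv, Fin.univ_val_map]
  change ((L.map fun r => r ε : List ℝ) : Multiset ℝ) = _
  congr 1
  apply List.ext_get <;> simp

/-! ### Asymptotics of bilinear forms of the scaled kernel -/

/-- Cauchy's mean value theorem against `t^(q+1)`, iterated. Only pointwise differentiability is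
needed, unlike for an integral remainder. -/
lemma exists_eq_iterated_deriv_mul_pow (q : ℕ) : ∀ (φ : ℕ → ℝ → ℝ) (ε : ℝ), 0 < ε →
    (∀ l < q, ∀ t ∈ Set.Icc 0 ε, HasDerivAt (φ l) (φ (l + 1) t) t) → (∀ l < q, φ l 0 = 0) →
    ∃ ξ ∈ Set.Ioc 0 ε, φ 0 ε = ε ^ q / q.factorial * φ q ξ := by
  induction q with
  | zero => exact fun φ ε hε _ _ => ⟨ε, ⟨hε, le_rfl⟩, by simp⟩
  | succ q ih =>
    intro φ ε hε hd h0
    obtain ⟨c, hc, hceq⟩ := exists_ratio_hasDerivAt_eq_ratio_slope (φ 0) (φ 1) hε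
      (fun t ht => (hd 0 q.succ_pos t ht).continuousAt.continuousWithinAt)
      (fun t ht => hd 0 q.succ_pos t (Set.Ioo_subset_Icc_self ht))
      (fun t => t ^ (q + 1)) (fun t => ((q + 1 : ℕ) : ℝ) * t ^ q)
      (continuous_pow _).continuousOn (fun t _ => by simpa using hasDerivAt_pow (q + 1) t)
    obtain ⟨ξ, hξ, hξeq⟩ := ih (fun l => φ (l + 1)) c hc.1
      (fun l hl t ht => hd (l + 1) (by omega) t ⟨ht.1, ht.2.trans hc.2.le⟩)
      (fun l hl => h0 (l + 1) (by omega))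
    refine ⟨ξ, ⟨hξ.1, hξ.2.trans hc.2.le⟩, ?_⟩
    simp only [zero_add] at hξeq
    rw [h0 0 q.succ_pos, hξeq, zero_pow q.succ_ne_zero, sub_zero, sub_zero] at hceq
    have hcq : c ^ q ≠ 0 := pow_ne_zero _ hc.1.ne'
    have hf : (q.factorial : ℝ) ≠ 0 := Nat.cast_ne_zero.2 q.factorial_ne_zero
    have hq : ((q + 1 : ℕ) : ℝ) ≠ 0 := Nat.cast_ne_zero.2 q.succ_ne_zero
    rw [Nat.factorial_succ, Nat.cast_mul]
    have : φ 0 ε * (((q + 1 : ℕ) : ℝ) * q.factorial) = ε ^ (q + 1) * φ (q + 1) ξ := by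
      field_simp at hceq
      push_cast at hceq ⊢
      linear_combination -hceq
    field_simp
    linear_combination this

lemma IsKernelOfClass.hasDerivAt_snd {l : ℕ} {a : ℝ} {K : ℝ → ℝ → ℝ} (hK : IsKernelOfClass l a K)
    {j : ℕ} (hj : j < l) {x y : ℝ} (hx : x ∈ Set.Ioo (-a) a) (hy : y ∈ Set.Ioo (-a) a) :
    HasDerivAt (fun v => mixedDeriv K 0 j x v) (mixedDeriv K 0 (j + 1) x y) y := by
  have h := (hK.differentiable_snd j hj x hx y hy).hasDerivAt
  simpa only [mixedDeriv, iteratedDeriv_zero, iteratedDeriv_succ] using h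

lemma IsKernelOfClass.hasDerivAt_fst {l : ℕ} {a : ℝ} {K : ℝ → ℝ → ℝ} (hK : IsKernelOfClass l a K)
    {i j : ℕ} (hi : i < l) (hj : j ≤ l) {x y : ℝ} (hx : x ∈ Set.Ioo (-a) a)
    (hy : y ∈ Set.Ioo (-a) a) :
    HasDerivAt (fun u => mixedDeriv K i j u y) (mixedDeriv K (i + 1) j x y) x := by
  have h := (hK.differentiable_fst i hi j hj x hx y hy).hasDerivAt
  simpa only [mixedDeriv, iteratedDeriv_succ] using h

/-- The exact mean value form of a bilinear form of the scaled kernel matrix at weights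
annihilating low-degree monomials on the nodes. -/
lemma IsKernelOfClass.exists_bilin_eq {n : ℕ} {a : ℝ} {K : ℝ → ℝ → ℝ}
    (hK : IsKernelOfClass n a K) {ι : Type*} [Fintype ι] {x v w : ι → ℝ} {p q : ℕ} (hp : p ≤ n)
    (hq : q ≤ n) (hv : ∀ l < p, ∑ i, v i * x i ^ l = 0) (hw : ∀ l < q, ∑ j, w j * x j ^ l = 0)
    {ε : ℝ} (hε : 0 < ε) (hx : ∀ i, ∀ t ∈ Set.Icc 0 ε, t * x i ∈ Set.Ioo (-a) a) :
    ∃ ξ ∈ Set.Ioc 0 ε, ∃ η ∈ Set.Ioc 0 ε, ∑ i, ∑ j, v i * w j * K (ε * x i) (ε * x j) =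
      ε ^ (p + q) / (p.factorial * q.factorial) *
        ∑ i, ∑ j, v i * w j * x i ^ p * x j ^ q * mixedDeriv K p q (ξ * x i) (η * x j) := by
  have hlin : ∀ (z t : ℝ), HasDerivAt (fun t : ℝ => t * z) z t := fun z t => by
    simpa using (hasDerivAt_id t).mul_const z
  -- The second argument is scaled first, with the first frozen at `ε * x i`; then the first is
  -- scaled with `η` frozen. Separating the variables uses only derivatives up to order `(p, q)`,
  -- taken in the order in which `mixedDeriv` takes them.
  obtain ⟨η, hη, hηeq⟩ := exists_eq_iterated_deriv_mul_pow q
    (fun l t => ∑ j, ∑ i, v i * w j * x j ^ l * mixedDeriv K 0 l (ε * x i) (t * x j)) ε hε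
    (fun l hl t ht => by
      refine HasDerivAt.fun_sum fun j _ => HasDerivAt.fun_sum fun i _ => ?_
      have := ((hK.hasDerivAt_snd (hl.trans_le hq) (hx i ε ⟨hε.le, le_rfl⟩)
        (hx j t ht)).comp t (hlin (x j) t)).const_mul (v i * w j * x j ^ l)
      refine this.congr_deriv ?_
      ring)
    (fun l hl => by
      rw [Finset.sum_comm]
      refine Finset.sum_eq_zero fun i _ => ?_
      calc _ = v i * mixedDeriv K 0 l (ε * x i) 0 * ∑ j, w j * x j ^ l := by
            rw [Finset.mul_sum]
            exact Finset.sum_congr rfl fun j _ => by rw [zero_mul]; ring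
        _ = 0 := by rw [hw l hl, mul_zero])
  obtain ⟨ξ, hξ, hξeq⟩ := exists_eq_iterated_deriv_mul_pow p
    (fun l t => ∑ j, ∑ i, v i * w j * x i ^ l * x j ^ q *
      mixedDeriv K l q (t * x i) (η * x j)) ε hε
    (fun l hl t ht => by
      refine HasDerivAt.fun_sum fun j _ => HasDerivAt.fun_sum fun i _ => ?_
      have := ((hK.hasDerivAt_fst (hl.trans_le hp) hq (hx i t ht)
        (hx j η ⟨hη.1.le, hη.2⟩)).comp t (hlin (x i) t)).const_mul
          (v i * w j * x i ^ l * x j ^ q)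
      refine this.congr_deriv ?_
      ring)
    (fun l hl => by
      refine Finset.sum_eq_zero fun j _ => ?_
      calc _ = w j * x j ^ q * mixedDeriv K l q 0 (η * x j) * ∑ i, v i * x i ^ l := by
            rw [Finset.mul_sum]
            exact Finset.sum_congr rfl fun i _ => by rw [zero_mul]; ring
        _ = 0 := by rw [hv l hl, mul_zero])
  refine ⟨ξ, hξ, η, hη, ?_⟩
  rw [Finset.sum_comm (f := fun i j => v i * w j * x i ^ p * x j ^ q *
    mixedDeriv K p q (ξ * x i) (η * x j)), pow_add, mul_div_mul_comm, mul_comm (ε ^ p / _),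
    mul_assoc, ← hξeq, Finset.sum_comm]
  simpa [mixedDeriv] using hηeq

/-- The intermediate points lie in `(0, ε]`, so continuity of the mixed derivative at the origin
suffices. -/
lemma IsKernelOfClass.tendsto_bilin {n : ℕ} {a : ℝ} (ha : 0 < a) {K : ℝ → ℝ → ℝ}
    (hK : IsKernelOfClass n a K) {ι : Type*} [Fintype ι] {x v w : ι → ℝ} {p q : ℕ} (hp : p ≤ n)
    (hq : q ≤ n) (hv : ∀ l < p, ∑ i, v i * x i ^ l = 0) (hw : ∀ l < q, ∑ j, w j * x j ^ l = 0) :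
    Tendsto (fun ε : ℝ => (∑ i, ∑ j, v i * w j * K (ε * x i) (ε * x j)) / ε ^ (p + q)) (𝓝[>] 0)
      (𝓝 ((∑ i, v i * x i ^ p) * (∑ j, w j * x j ^ q) *
        (mixedDeriv K p q 0 0 / (p.factorial * q.factorial)))) := by
  have hsmall : ∀ᶠ ε in 𝓝[>] (0 : ℝ), 0 < ε ∧
      ∀ i, ∀ t ∈ Set.Icc 0 ε, t * x i ∈ Set.Ioo (-a) a := by
    refine (eventually_nhdsWithin_of_forall fun ε h => h).and (eventually_all.2 fun i => ?_)
    have hlt : ∀ᶠ ε in 𝓝 (0 : ℝ), ε * |x i| < a :=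
      (continuous_id.mul continuous_const).continuousAt.eventually_lt_const (by simpa using ha)
    filter_upwards [nhdsWithin_le_nhds hlt] with ε h t ht
    refine abs_lt.1 ?_
    rw [abs_mul, abs_of_nonneg ht.1]
    exact (mul_le_mul_of_nonneg_right ht.2 (abs_nonneg _)).trans_lt h
  have hex : ∀ ε : ℝ, ∃ z : ℝ × ℝ, (0 < ε ∧ ∀ i, ∀ t ∈ Set.Icc 0 ε, t * x i ∈ Set.Ioo (-a) a) →
      z.1 ∈ Set.Ioc 0 ε ∧ z.2 ∈ Set.Ioc 0 ε ∧ ∑ i, ∑ j, v i * w j * K (ε * x i) (ε * x j) =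
      ε ^ (p + q) / (p.factorial * q.factorial) *
        ∑ i, ∑ j, v i * w j * x i ^ p * x j ^ q * mixedDeriv K p q (z.1 * x i) (z.2 * x j) := by
    intro ε
    by_cases h : 0 < ε ∧ ∀ i, ∀ t ∈ Set.Icc 0 ε, t * x i ∈ Set.Ioo (-a) a
    · obtain ⟨ξ, hξ, η, hη, he⟩ := hK.exists_bilin_eq hp hq hv hw h.1 h.2
      exact ⟨(ξ, η), fun _ => ⟨hξ, hη, he⟩⟩
    · exact ⟨0, fun h' => absurd h' h⟩
  choose z hz using hex
  have hcont : ContinuousAt (fun p' : ℝ × ℝ => mixedDeriv K p q p'.1 p'.2) (0, 0) := by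
    refine (hK.continuousOn p hp q hq).continuousAt (IsOpen.mem_nhds
      (isOpen_Ioo.prod isOpen_Ioo) ⟨⟨?_, ?_⟩, ⟨?_, ?_⟩⟩) <;> simp [ha]
  generalize mixedDeriv K p q = D at hz hcont ⊢
  have hid : Tendsto (fun ε : ℝ => ε) (𝓝[>] 0) (𝓝 0) := tendsto_id.mono_left nhdsWithin_le_nhds
  have hz1 : Tendsto (fun ε => (z ε).1) (𝓝[>] 0) (𝓝 0) := by
    refine tendsto_of_tendsto_of_tendsto_of_le_of_le' tendsto_const_nhds hid ?_ ?_ <;>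
    filter_upwards [hsmall] with ε h
    exacts [(hz ε h).1.1.le, (hz ε h).1.2]
  have hz2 : Tendsto (fun ε => (z ε).2) (𝓝[>] 0) (𝓝 0) := by
    refine tendsto_of_tendsto_of_tendsto_of_le_of_le' tendsto_const_nhds hid ?_ ?_ <;>
    filter_upwards [hsmall] with ε h
    exacts [(hz ε h).2.1.1.le, (hz ε h).2.1.2]
  have hlim : Tendsto (fun ε => 1 / ((p.factorial : ℝ) * q.factorial) *
      ∑ i, ∑ j, v i * w j * x i ^ p * x j ^ q * D ((z ε).1 * x i) ((z ε).2 * x j))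
      (𝓝[>] 0) (𝓝 (1 / ((p.factorial : ℝ) * q.factorial) *
        ∑ i, ∑ j, v i * w j * x i ^ p * x j ^ q * D 0 0)) := by
    refine Tendsto.const_mul _ (tendsto_finsetSum _ fun i _ => tendsto_finsetSum _ fun j _ => ?_)
    refine Tendsto.const_mul _ (Tendsto.comp (x := 𝓝[>] (0 : ℝ))
      (f := fun ε => ((z ε).1 * x i, (z ε).2 * x j)) hcont.tendsto ?_)
    refine Tendsto.prodMk_nhds ?_ ?_
    · simpa using hz1.mul_const (x i)
    · simpa using hz2.mul_const (x j)
  have hval : (1 / ((p.factorial : ℝ) * q.factorial) *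
      ∑ i, ∑ j, v i * w j * x i ^ p * x j ^ q * D 0 0) =
      (∑ i, v i * x i ^ p) * (∑ j, w j * x j ^ q) *
        (D 0 0 / (p.factorial * q.factorial)) := by
    rw [Finset.sum_mul_sum, Finset.mul_sum, Finset.sum_mul]
    refine Finset.sum_congr rfl fun i _ => ?_
    rw [Finset.mul_sum, Finset.sum_mul]
    exact Finset.sum_congr rfl fun j _ => by ring
  rw [← hval]
  refine hlim.congr' ?_
  filter_upwards [hsmall] with ε h
  rw [(hz ε h).2.2]
  have : ε ^ (p + q) ≠ 0 := pow_ne_zero _ h.1.ne'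
  field_simp

/-! ### Eigenvalues of graded families -/

lemma Matrix.IsHermitian.exists_orthogonal_sortedEigenvalue {n : ℕ}
    {A : Matrix (Fin n) (Fin n) ℝ} (hA : A.IsHermitian) :
    ∃ U : Matrix (Fin n) (Fin n) ℝ, Uᵀ * U = 1 ∧
      Uᵀ * A * U = Matrix.diagonal (sortedEigenvalue A) := by
  set π : Equiv.Perm (Fin n) := (finCongr (Fintype.card_fin n).symm).trans
    (Fintype.equivOfCardEq (Fintype.card_fin _))
  have hπ : ∀ s, sortedEigenvalue A s = hA.eigenvalues (π s) := fun s => by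
    simp only [sortedEigenvalue, dif_pos hA, Matrix.IsHermitian.eigenvalues, π, Equiv.trans_apply,
      Equiv.symm_apply_apply]
    rfl
  set U₀ : Matrix (Fin n) (Fin n) ℝ := (hA.eigenvectorUnitary : Matrix (Fin n) (Fin n) ℝ)
  have h1 : U₀ᵀ * U₀ = 1 := by
    have := Unitary.coe_star_mul_self hA.eigenvectorUnitary
    rwa [Matrix.star_eq_conjTranspose, Matrix.conjTranspose_eq_transpose_of_trivial] at this
  have h2 : U₀ᵀ * A * U₀ = Matrix.diagonal hA.eigenvalues := by
    have := hA.conjStarAlgAut_star_eigenvectorUnitary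
    rw [Unitary.conjStarAlgAut_star_apply, Matrix.star_eq_conjTranspose,
      Matrix.conjTranspose_eq_transpose_of_trivial] at this
    exact this
  refine ⟨U₀.submatrix id π, ?_, ?_⟩
  · change (U₀ᵀ * U₀).submatrix π π = 1
    rw [h1, Matrix.submatrix_one_equiv]
  · change (U₀ᵀ * A * U₀).submatrix π π = _
    rw [h2, Matrix.submatrix_diagonal_equiv]
    congr 1
    ext s
    exact (hπ s).symm

/-- Half of Courant–Fischer: the span of the top `s + 1` eigenvectors meets the subspace cut out by
`s` linear conditions in a nonzero vector. -/
lemma sortedEigenvalue_le_of_forall {n : ℕ} {A : Matrix (Fin n) (Fin n) ℝ} (hA : A.IsHermitian)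
    (s : Fin n) {c : ℝ}
    (h : ∀ v : Fin n → ℝ, (∀ p < s, v p = 0) → v ⬝ᵥ A *ᵥ v ≤ c * (v ⬝ᵥ v)) :
    sortedEigenvalue A s ≤ c := by
  obtain ⟨U, hU, hUA⟩ := hA.exists_orthogonal_sortedEigenvalue
  obtain ⟨y, hys, hy0, hy⟩ : ∃ y : Fin n → ℝ, (∀ i, s < i → y i = 0) ∧ y ≠ 0 ∧
      ∀ p < s, (U *ᵥ y) p = 0 := by
    let ext : (Set.Iic s → ℝ) →ₗ[ℝ] (Fin n → ℝ) := Function.ExtendByZero.linearMap ℝ Subtype.val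
    let res : (Fin n → ℝ) →ₗ[ℝ] (Set.Iio s → ℝ) := LinearMap.funLeft ℝ ℝ Subtype.val
    have hker : LinearMap.ker (res ∘ₗ U.mulVecLin ∘ₗ ext) ≠ ⊥ := by
      apply LinearMap.ker_ne_bot_of_finrank_lt
      simp
    obtain ⟨z, hz, hz0⟩ := Submodule.exists_mem_ne_zero_of_ne_bot hker
    have hext : ∀ i : Set.Iic s, ext z i = z i := fun i =>
      Subtype.val_injective.extend_apply z 0 i
    refine ⟨ext z, fun i hi => ?_, fun h0 => hz0 ?_, fun p hp => ?_⟩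
    · exact Function.extend_apply' (f := Subtype.val) z (0 : Fin n → ℝ) i
        fun ⟨j, hj⟩ => (not_lt.2 (hj ▸ j.2 : i ≤ s)) hi
    · ext i
      rw [← hext, h0]; rfl
    · exact congrFun (LinearMap.mem_ker.1 hz) ⟨p, hp⟩
  have h1 := h (U *ᵥ y) hy
  have e1 : (U *ᵥ y) ⬝ᵥ (U *ᵥ y) = y ⬝ᵥ y := by
    rw [Matrix.dotProduct_mulVec, ← Matrix.mulVec_transpose, Matrix.mulVec_mulVec, hU,
      Matrix.one_mulVec]
  have e2 : (U *ᵥ y) ⬝ᵥ A *ᵥ (U *ᵥ y) = ∑ i, sortedEigenvalue A i * y i ^ 2 := by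
    rw [dotProduct_comm, Matrix.dotProduct_mulVec, ← Matrix.mulVec_transpose, Matrix.mulVec_mulVec,
      Matrix.mulVec_mulVec, hUA, dotProduct_comm]
    simp only [dotProduct, Matrix.mulVec_diagonal]
    exact Finset.sum_congr rfl fun i _ => by ring
  have hpos : 0 < y ⬝ᵥ y := by
    obtain ⟨i, hi⟩ := Function.ne_iff.1 hy0
    exact Finset.sum_pos' (fun i _ => mul_self_nonneg _)
      ⟨i, Finset.mem_univ i, mul_self_pos.2 hi⟩
  have h2 : sortedEigenvalue A s * (y ⬝ᵥ y) ≤ ∑ i, sortedEigenvalue A i * y i ^ 2 := by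
    rw [dotProduct, Finset.mul_sum]
    refine Finset.sum_le_sum fun i _ => ?_
    rcases le_or_gt i s with hi | hi
    · rw [pow_two]
      exact mul_le_mul_of_nonneg_right (sortedEigenvalue_antitone A hi) (mul_self_nonneg _)
    · simp [hys i hi]
  rw [e1, e2] at h1
  exact le_of_mul_le_mul_right (h2.trans h1) hpos

lemma sortedEigenvalue_nonneg {n : ℕ} {A : Matrix (Fin n) (Fin n) ℝ} (hA : A.PosSemidef)
    (s : Fin n) : 0 ≤ sortedEigenvalue A s := by
  have hmem : sortedEigenvalue A s ∈ A.charpoly.roots := by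
    rw [← map_univ_sortedEigenvalue hA.1]
    exact Multiset.mem_map_of_mem _ (Finset.mem_univ_val s)
  rw [hA.1.roots_charpoly_eq_eigenvalues] at hmem
  obtain ⟨i, -, hi⟩ := Multiset.mem_map.1 hmem
  rw [← hi]
  exact hA.eigenvalues_nonneg i

lemma sortedEigenvalue_eq_of_charpoly_eq {n : ℕ} {A B : Matrix (Fin n) (Fin n) ℝ}
    (hA : A.IsHermitian) (hB : B.IsHermitian) (h : A.charpoly = B.charpoly) :
    sortedEigenvalue A = sortedEigenvalue B :=
  (sortedEigenvalue_antitone A).eq_of_map_univ_eq (sortedEigenvalue_antitone B) (by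
    rw [map_univ_sortedEigenvalue hA, map_univ_sortedEigenvalue hB, h])

lemma det_add_smul_one_eq_prod {n : ℕ} {A : Matrix (Fin n) (Fin n) ℝ} (hA : A.IsHermitian)
    (t : ℝ) : (t • (1 : Matrix (Fin n) (Fin n) ℝ) + A).det = ∏ s, (t + sortedEigenvalue A s) := by
  have h := Matrix.eval_charpoly A (-t)
  rw [charpoly_eq_prod_sortedEigenvalue hA, Polynomial.eval_prod] at h
  have e : t • (1 : Matrix (Fin n) (Fin n) ℝ) + A = -(Matrix.scalar (Fin n) (-t) - A) := by
    rw [Matrix.scalar_apply, ← Matrix.smul_one_eq_diagonal]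
    module
  rw [e, Matrix.det_neg, ← h, Fintype.card_fin]
  have : (-1 : ℝ) ^ n = ∏ _s : Fin n, (-1 : ℝ) := by simp
  rw [this, ← Finset.prod_mul_distrib]
  exact Finset.prod_congr rfl fun s _ => by simp; ring

/-- Eigenvalues of a positive semidefinite family whose entries scale like `ε ^ (p + q)`. -/
lemma isBigO_sortedEigenvalue_of_graded {n : ℕ} {B : ℝ → Matrix (Fin n) (Fin n) ℝ}
    {M : Matrix (Fin n) (Fin n) ℝ} (hB : ∀ᶠ ε in 𝓝[>] (0 : ℝ), (B ε).PosSemidef)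
    (hM : ∀ p q, Tendsto (fun ε : ℝ => B ε p q / ε ^ ((p : ℕ) + q)) (𝓝[>] 0) (𝓝 (M p q)))
    (s : Fin n) :
    (fun ε => sortedEigenvalue (B ε) s) =O[𝓝[>] 0] fun ε : ℝ => ε ^ (2 * (s : ℕ)) := by
  set c : ℝ := ∑ p, ∑ q, (|M p q| + 1)
  refine Asymptotics.IsBigO.of_bound c ?_
  have hbd : ∀ᶠ ε in 𝓝[>] (0 : ℝ), ∀ p q, |B ε p q / ε ^ ((p : ℕ) + q)| < |M p q| + 1 :=
    eventually_all.2 fun p => eventually_all.2 fun q =>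
      (hM p q).abs.eventually_lt_const (lt_add_one _)
  have hlt : ∀ᶠ ε in 𝓝[>] (0 : ℝ), ε < 1 := nhdsWithin_le_nhds (eventually_lt_nhds one_pos)
  filter_upwards [hB, hbd, hlt, self_mem_nhdsWithin] with ε h1 h2 h3 (h4 : 0 < ε)
  rw [Real.norm_of_nonneg (sortedEigenvalue_nonneg h1 s), Real.norm_of_nonneg (by positivity)]
  refine sortedEigenvalue_le_of_forall h1.1 s fun v hv => ?_
  have hvv : ∀ p, v p ^ 2 ≤ v ⬝ᵥ v := fun p => by
    rw [pow_two]
    exact Finset.single_le_sum (f := fun i => v i * v i) (fun i _ => mul_self_nonneg _)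
      (Finset.mem_univ p)
  have hterm : ∀ p q, v p * (B ε p q * v q) ≤
      (|M p q| + 1) * (ε ^ (2 * (s : ℕ)) * (v ⬝ᵥ v)) := fun p q => by
    have hnn : 0 ≤ (|M p q| + 1) * (ε ^ (2 * (s : ℕ)) * (v ⬝ᵥ v)) := by
      have := (sq_nonneg _).trans (hvv p)
      positivity
    rcases lt_or_ge p s with hp | hp
    · simpa [hv p hp] using hnn
    rcases lt_or_ge q s with hq | hq
    · simpa [hv q hq] using hnn
    have hvpq : |v p * v q| ≤ v ⬝ᵥ v := by
      rw [abs_mul]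
      nlinarith [hvv p, hvv q, sq_abs (v p), sq_abs (v q), sq_nonneg (|v p| - |v q|)]
    -- Only indices `p, q ≥ s` remain, and `p + q ≥ 2s` gives `ε^(p+q) ≤ ε^(2s)` because `ε < 1`.
    have hBpq : |B ε p q| ≤ (|M p q| + 1) * ε ^ (2 * (s : ℕ)) := by
      have hb := (h2 p q).le
      rw [abs_div, abs_of_pos (pow_pos h4 _), div_le_iff₀ (pow_pos h4 _)] at hb
      refine hb.trans (mul_le_mul_of_nonneg_left ?_ (by positivity))
      have hp' : (s : ℕ) ≤ p := hp
      have hq' : (s : ℕ) ≤ q := hq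
      exact pow_le_pow_of_le_one h4.le h3.le (by omega)
    calc v p * (B ε p q * v q) ≤ |B ε p q| * |v p * v q| := by
          rw [← abs_mul]
          exact (le_abs_self _).trans_eq (by ring_nf)
      _ ≤ (|M p q| + 1) * ε ^ (2 * (s : ℕ)) * (v ⬝ᵥ v) := by gcongr
      _ = _ := by ring
  calc v ⬝ᵥ B ε *ᵥ v = ∑ p, ∑ q, v p * (B ε p q * v q) := by
        simp only [dotProduct, Matrix.mulVec, Finset.mul_sum]
    _ ≤ ∑ p, ∑ q, (|M p q| + 1) * (ε ^ (2 * (s : ℕ)) * (v ⬝ᵥ v)) :=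
        Finset.sum_le_sum fun p _ => Finset.sum_le_sum fun q _ => hterm p q
    _ = c * ε ^ (2 * (s : ℕ)) * (v ⬝ᵥ v) := by
        simp only [c, Finset.sum_mul, mul_assoc]

/-- The leading block of a matrix indexed by `Fin n`. -/
noncomputable def leadingBlock {n : ℕ} (M : Matrix (Fin n) (Fin n) ℝ) (s : Fin n) :
    Matrix (Fin (s + 1)) (Fin (s + 1)) ℝ :=
  M.submatrix (Fin.castLE s.2) (Fin.castLE s.2)

lemma det_eq_det_leadingBlock {n : ℕ} {N M : Matrix (Fin n) (Fin n) ℝ} (s : Fin n)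
    (hlead : ∀ p ≤ s, ∀ q ≤ s, N p q = M p q)
    (hcol : ∀ p q, s < q → N p q = if p = q then 1 else 0) :
    N.det = (leadingBlock M s).det := by
  rw [Matrix.twoBlockTriangular_det' N (fun i => i ≤ s) (fun i hi j hj => by
    rw [hcol i j (not_le.1 hj), if_neg]
    rintro rfl; exact hj hi)]
  have h1 : N.toSquareBlockProp (fun i => ¬ i ≤ s) = 1 := by
    ext i j
    rw [Matrix.toSquareBlockProp_def, Matrix.of_apply, hcol _ _ (not_le.1 j.2), Matrix.one_apply]
    simp [Subtype.ext_iff]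
  let e : Fin (s + 1) ≃ {i : Fin n // i ≤ s} :=
    { toFun := fun i => ⟨Fin.castLE s.2 i, Fin.le_def.2 (Nat.lt_succ_iff.1 i.2)⟩
      invFun := fun i => ⟨i.1, Nat.lt_succ_iff.2 (Fin.le_def.1 i.2)⟩
      left_inv := fun i => rfl
      right_inv := fun i => rfl }
  have h2 : leadingBlock M s = (N.toSquareBlockProp (fun i => i ≤ s)).submatrix e e := by
    ext i j
    exact (hlead _ (e i).2 _ (e j).2).symm
  rw [h1, Matrix.det_one, mul_one, h2, Matrix.det_submatrix_equiv_self]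

/-- The odd exponent in `ε^(2s+1) I` lies strictly between `2s` and `2(s+1)`: the shift is
negligible for the first `s + 1` eigenvalues and dominates the others. After normalisation the
determinant therefore retains only the wanted product. -/
lemma prod_leading_eq_det_of_graded {n : ℕ} {B : ℝ → Matrix (Fin n) (Fin n) ℝ}
    {M : Matrix (Fin n) (Fin n) ℝ} (hB : ∀ᶠ ε in 𝓝[>] (0 : ℝ), (B ε).IsHermitian)
    (hM : ∀ p q, Tendsto (fun ε : ℝ => B ε p q / ε ^ ((p : ℕ) + q)) (𝓝[>] 0) (𝓝 (M p q)))
    {μ : Fin n → ℝ}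
    (hμ : ∀ i, Tendsto (fun ε : ℝ => sortedEigenvalue (B ε) i / ε ^ (2 * (i : ℕ)))
      (𝓝[>] 0) (𝓝 (μ i))) (s : Fin n) :
    ∏ i ∈ Finset.Iic s, μ i = (leadingBlock M s).det := by
  have hpow0 : ∀ m : ℕ, m ≠ 0 → Tendsto (fun ε : ℝ => ε ^ m) (𝓝[>] 0) (𝓝 0) := fun m hm => by
    have := (continuous_pow m).tendsto (0 : ℝ)
    rw [zero_pow hm] at this
    exact this.mono_left nhdsWithin_le_nhds
  have hratio : ∀ m e : ℕ, e ≤ m →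
      (fun ε : ℝ => ε ^ m / ε ^ e) =ᶠ[𝓝[>] 0] fun ε => ε ^ (m - e) := fun m e he => by
    filter_upwards [self_mem_nhdsWithin] with ε (hε : 0 < ε)
    rw [div_eq_iff (pow_pos hε _).ne', ← pow_add, Nat.sub_add_cancel he]
  have hdiv : ∀ {f : ℝ → ℝ} {L : ℝ} {m e : ℕ}, e ≤ m →
      Tendsto (fun ε => f ε / ε ^ m) (𝓝[>] 0) (𝓝 L) →
      Tendsto (fun ε => f ε / ε ^ e) (𝓝[>] 0) (𝓝 (if m = e then L else 0)) := by
    intro f L m e he hf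
    split_ifs with hme
    · rwa [← hme]
    · have := hf.mul (hpow0 (m - e) (by omega))
      rw [mul_zero] at this
      refine this.congr' ?_
      filter_upwards [self_mem_nhdsWithin, hratio m e he] with ε (hε : 0 < ε) h
      rw [← h]
      field_simp
  -- Row and column exponents are capped asymmetrically, at `s + 1` and `s`, so that past `s` a
  -- diagonal entry is divided by exactly `ε^(2s+1)`. A limit of `B` survives only for `p ≤ s + 1`
  -- and `q ≤ s`; row `s + 1` may stay nonzero, but the columns past `s` become unit vectors.
  set r : Fin n → ℕ := fun p => min (p : ℕ) (s + 1)
  set d : Fin n → ℕ := fun q => min (q : ℕ) s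
  set N : ℝ → Matrix (Fin n) (Fin n) ℝ := fun ε =>
    Matrix.of fun p q => ((ε ^ (2 * (s : ℕ) + 1)) • (1 : Matrix (Fin n) (Fin n) ℝ) + B ε) p q /
      ε ^ (r p + d q)
  set N₀ : Matrix (Fin n) (Fin n) ℝ := Matrix.of fun p q =>
    (if p = q then (if s < p then 1 else 0) else 0) + (if (p : ℕ) + q = r p + d q then M p q else 0)
  have hN : Tendsto (fun ε => (N ε).det) (𝓝[>] 0) (𝓝 N₀.det) := by
    refine (continuous_id.matrix_det.tendsto N₀).comp ?_
    refine tendsto_pi_nhds.2 fun p => tendsto_pi_nhds.2 fun q => ?_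
    have e1 : ∀ ε, N ε p q = (if p = q then ε ^ (2 * (s : ℕ) + 1) / ε ^ (r p + d q) else 0) +
        B ε p q / ε ^ (r p + d q) := fun ε => by
      simp only [N, Matrix.of_apply, Matrix.add_apply, Matrix.smul_apply, Matrix.one_apply, add_div,
        smul_eq_mul, mul_ite, mul_one, mul_zero, ite_div, zero_div]
    change Tendsto (fun ε => N ε p q) _ _
    simp only [e1]
    refine Tendsto.add ?_ (hdiv (add_le_add (min_le_left _ _) (min_le_left _ _)) (hM p q))
    by_cases hpq : p = q
    · subst hpq
      simp only [if_true]
      rcases lt_or_ge s p with hsp | hsp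
      · have hsp' : (s : ℕ) < p := hsp
        refine Tendsto.congr' (hratio _ _ ?_).symm ?_
        · simp only [r, d]; omega
        · rw [show 2 * (s : ℕ) + 1 - (r p + d p) = 0 by simp only [r, d]; omega]
          simp [hsp]
      · have hsp' : (p : ℕ) ≤ s := hsp
        refine Tendsto.congr' (hratio _ _ ?_).symm ?_
        · simp only [r, d]; omega
        · rw [if_neg (not_lt.2 hsp)]
          exact hpow0 _ (by simp only [r, d]; omega)
    · simp [hpq]
  have hN0 : N₀.det = (leadingBlock M s).det := by
    refine det_eq_det_leadingBlock s (fun p hp q hq => ?_) fun p q hq => ?_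
    · have hp' : (p : ℕ) ≤ s := hp
      have hq' : (q : ℕ) ≤ s := hq
      simp only [N₀, Matrix.of_apply, if_neg (not_lt.2 hp), ite_self, zero_add]
      rw [if_pos]
      simp only [r, d]; omega
    · have hq' : (s : ℕ) < q := hq
      simp only [N₀, Matrix.of_apply]
      rw [if_neg (c := (p : ℕ) + q = r p + d q) (by simp only [r, d]; omega), add_zero]
      split_ifs with h1 h2
      · rfl
      · exact absurd (h1 ▸ hq) h2
      · rfl
  have hprod : Tendsto (fun ε => ∏ p, ((ε ^ (2 * (s : ℕ) + 1) + sortedEigenvalue (B ε) p) /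
      ε ^ (r p + d p))) (𝓝[>] 0) (𝓝 (∏ p, if p ≤ s then μ p else 1)) := by
    refine tendsto_finsetProd _ fun p _ => ?_
    simp only [add_div]
    have h2 := hdiv (e := r p + d p) (by simp only [r, d]; omega) (hμ p)
    rcases lt_or_ge s p with hsp | hsp
    · have hsp' : (s : ℕ) < p := hsp
      rw [if_neg (by simp only [r, d]; omega)] at h2
      rw [if_neg (not_le.2 hsp)]
      have h1 : Tendsto (fun ε : ℝ => ε ^ (2 * (s : ℕ) + 1) / ε ^ (r p + d p)) (𝓝[>] 0) (𝓝 1) := by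
        refine Tendsto.congr' (hratio _ _ ?_).symm ?_
        · simp only [r, d]; omega
        · rw [show 2 * (s : ℕ) + 1 - (r p + d p) = 0 by simp only [r, d]; omega]
          simp
      simpa using h1.add h2
    · have hsp' : (p : ℕ) ≤ s := hsp
      rw [if_pos (by simp only [r, d]; omega)] at h2
      rw [if_pos hsp]
      have h1 : Tendsto (fun ε : ℝ => ε ^ (2 * (s : ℕ) + 1) / ε ^ (r p + d p)) (𝓝[>] 0) (𝓝 0) := by
        refine Tendsto.congr' (hratio _ _ ?_).symm ?_
        · simp only [r, d]; omega
        · exact hpow0 _ (by simp only [r, d]; omega)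
      simpa using h1.add h2
  have heq : (fun ε => ∏ p, ((ε ^ (2 * (s : ℕ) + 1) + sortedEigenvalue (B ε) p) /
      ε ^ (r p + d p))) =ᶠ[𝓝[>] 0] fun ε => (N ε).det := by
    filter_upwards [hB] with ε h
    have e2 : N ε = Matrix.of fun p q => (ε ^ r p)⁻¹ * (Matrix.of fun p' q' => (ε ^ d q')⁻¹ *
        ((ε ^ (2 * (s : ℕ) + 1)) • (1 : Matrix (Fin n) (Fin n) ℝ) + B ε) p' q') p q := by
      ext p q
      simp only [N, Matrix.of_apply, pow_add, div_eq_mul_inv, mul_inv]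
      ring
    rw [e2, Matrix.det_mul_column, Matrix.det_mul_row, det_add_smul_one_eq_prod h,
      ← Finset.prod_mul_distrib, ← Finset.prod_mul_distrib]
    refine Finset.prod_congr rfl fun p _ => ?_
    rw [div_eq_mul_inv, pow_add ε (r p), mul_inv]
    ring
  have hfin := tendsto_nhds_unique (hprod.congr' heq) hN
  rw [hN0] at hfin
  rw [← hfin, ← Finset.prod_filter]
  refine Finset.prod_congr ?_ fun _ _ => rfl
  ext i; simp

/-! ### The adapted orthogonal basis and its determinants -/

/-- An orthogonal matrix whose column `p` annihilates the monomials of degree `< p` on the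
nodes. -/
lemma exists_orthogonal_annihilating {n : ℕ} (x : Fin n → ℝ) :
    ∃ Q : Matrix (Fin n) (Fin n) ℝ, Qᵀ * Q = 1 ∧
      ∀ p : Fin n, ∀ l < (p : ℕ), ∑ i, Q i p * x i ^ l = 0 := by
  let f : Fin n → EuclideanSpace ℝ (Fin n) := fun j => WithLp.toLp 2 fun i => x i ^ (j : ℕ)
  -- This version completes the Gram–Schmidt vectors to an orthonormal basis, so repeated nodes,
  -- which make `f` linearly dependent, do no harm.
  let u := InnerProductSpace.gramSchmidtOrthonormalBasis
    (𝕜 := ℝ) (E := EuclideanSpace ℝ (Fin n)) (by simp) f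
  refine ⟨Matrix.of fun i p => u p i, ?_, fun p l hl => ?_⟩
  · ext p q
    have h := (orthonormal_iff_ite.1 u.orthonormal) p q
    rw [PiLp.inner_apply] at h
    rw [Matrix.mul_apply, Matrix.one_apply, ← h]
    exact Finset.sum_congr rfl fun i _ => by simp [mul_comm]
  · have h := InnerProductSpace.gramSchmidtOrthonormalBasis_inv_triangular
      (𝕜 := ℝ) (E := EuclideanSpace ℝ (Fin n)) (by simp) f
      (i := ⟨l, hl.trans p.2⟩) (j := p) hl
    rw [PiLp.inner_apply] at h
    rw [← h]
    exact Finset.sum_congr rfl fun i _ => by simp [f, u, mul_comm]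

/-- A QR factorisation: `Qᵀ V` is upper triangular with zero rows past `s`, so the Gram determinant
is the square of the product of its diagonal entries. -/
lemma det_gram_vandermondeUpTo {n : ℕ} {x : Fin n → ℝ} {Q : Matrix (Fin n) (Fin n) ℝ}
    (hQ : Qᵀ * Q = 1) (hann : ∀ p : Fin n, ∀ l < (p : ℕ), ∑ i, Q i p * x i ^ l = 0) (s : Fin n) :
    ((vandermondeUpTo x s).transpose * vandermondeUpTo x s).det =
      (∏ k : Fin (s + 1), ∑ i, Q i (Fin.castLE s.2 k) * x i ^ (k : ℕ)) ^ 2 := by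
  set V := vandermondeUpTo x s
  set R : Matrix (Fin (s + 1)) (Fin (s + 1)) ℝ := (Qᵀ * V).submatrix (Fin.castLE s.2) id
  have hQV : ∀ p l, (Qᵀ * V) p l = ∑ i, Q i p * x i ^ (l : ℕ) := fun p l => by
    simp [Matrix.mul_apply, V, vandermondeUpTo]
  have hVV : Vᵀ * V = Rᵀ * R := by
    have h1 : Vᵀ * V = (Qᵀ * V)ᵀ * (Qᵀ * V) := by
      rw [Matrix.transpose_mul, Matrix.transpose_transpose, Matrix.mul_assoc, ← Matrix.mul_assoc Q,
        mul_eq_one_comm.1 hQ, Matrix.one_mul]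
    rw [h1]
    ext j k
    rw [Matrix.mul_apply, Matrix.mul_apply]
    symm
    refine Finset.sum_of_injOn (Fin.castLE s.2) (Fin.castLE_injective _).injOn
      (fun _ _ => Finset.mem_coe.2 (Finset.mem_univ _)) (fun p _ hp => ?_) (fun _ _ => rfl)
    have hps : (s : ℕ) < p := by
      by_contra hcon
      exact hp ⟨⟨p, by omega⟩, by simp, Fin.ext rfl⟩
    rw [Matrix.transpose_apply, hQV, hann p j (by omega), zero_mul]
  have hR : R.IsUpperTriangular := fun p q hpq => by
    change (Qᵀ * V) _ _ = 0
    rw [hQV]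
    exact hann _ _ hpq
  rw [hVV, Matrix.det_mul, Matrix.det_transpose, Matrix.det_of_isUpperTriangular hR, ← pow_two]
  exact congrArg (· ^ 2) (Finset.prod_congr rfl fun k _ => hQV _ _)

lemma det_leadingBlock_mul_mul {n : ℕ} (K : ℝ → ℝ → ℝ) (R : Fin n → ℝ) (s : Fin n) :
    (leadingBlock (Matrix.of fun p q : Fin n => R p * R q *
      (mixedDeriv K p q 0 0 / ((p : ℕ).factorial * (q : ℕ).factorial))) s).det =
      (∏ k : Fin (s + 1), R (Fin.castLE s.2 k)) ^ 2 * (wronskianMatrix K s).det := by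
  have h : leadingBlock (Matrix.of fun p q : Fin n => R p * R q *
      (mixedDeriv K p q 0 0 / ((p : ℕ).factorial * (q : ℕ).factorial))) s =
      Matrix.of fun p q => R (Fin.castLE s.2 p) *
        (Matrix.of fun p' q' => R (Fin.castLE s.2 q') * wronskianMatrix K s p' q') p q := by
    ext p q
    simp only [leadingBlock, Matrix.submatrix_apply, Matrix.of_apply, wronskianMatrix,
      Fin.val_castLE, mul_assoc]
  rw [h, Matrix.det_mul_column, Matrix.det_mul_row]
  ring

/-! ### The main theorem -/

theorem mainTheorem2 (n : ℕ) (a : ℝ) (ha : 0 < a) (K : ℝ → ℝ → ℝ)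
    (hK : IsKernelOfClass n a K) (x : Fin n → ℝ)
    (ε₀ : ℝ) (hε₀ : 0 < ε₀)
    (hpsd : ∀ ε ∈ Set.Icc 0 ε₀, (scaledKernelMatrix K x ε).PosSemidef)
    (hana : ∀ i j, AnalyticWithinAt ℝ (fun ε => scaledKernelMatrix K x ε i j) (Set.Ici 0) 0) :
    ∃ μ : Fin n → ℝ,
      (∀ s : Fin n,
        (fun ε : ℝ => sortedEigenvalue (scaledKernelMatrix K x ε) s
            - ε ^ (2 * (s : ℕ)) * μ s)
          =O[nhdsWithin 0 (Set.Ici 0)] (fun ε : ℝ => ε ^ (2 * (s : ℕ) + 1))) ∧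
      (∀ s : Fin n, ∏ i ∈ Finset.Iic s, μ i =
        ((vandermondeUpTo x s).transpose * vandermondeUpTo x s).det
          * (wronskianMatrix K s).det) := by
  set A := scaledKernelMatrix K x
  have hpsd' : ∀ᶠ ε in 𝓝[≥] (0 : ℝ), (A ε).PosSemidef := by
    filter_upwards [self_mem_nhdsWithin, nhdsWithin_le_nhds (eventually_le_nhds hε₀)] with ε h1 h2
    exact hpsd ε ⟨h1, h2⟩
  have hle : 𝓝[>] (0 : ℝ) ≤ 𝓝[≥] 0 := nhdsWithin_mono _ Set.Ioi_subset_Ici_self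
  obtain ⟨g, hg, hAg⟩ := exists_analyticAt_sortedEigenvalue hana (hpsd'.mono fun _ h => h.1)
  obtain ⟨Q, hQ, hann⟩ := exists_orthogonal_annihilating x
  set B : ℝ → Matrix (Fin n) (Fin n) ℝ := fun ε => Qᵀ * A ε * Q
  set R : Fin n → ℝ := fun p => ∑ i, Q i p * x i ^ (p : ℕ)
  set M : Matrix (Fin n) (Fin n) ℝ := Matrix.of fun p q : Fin n => R p * R q *
    (mixedDeriv K p q 0 0 / ((p : ℕ).factorial * (q : ℕ).factorial))
  have hBpsd : ∀ᶠ ε in 𝓝[>] (0 : ℝ), (B ε).PosSemidef := by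
    filter_upwards [hle hpsd'] with ε h
    simpa [B] using h.conjTranspose_mul_mul_same Q
  have hsort : ∀ᶠ ε in 𝓝[>] (0 : ℝ), ∀ s, sortedEigenvalue (B ε) s = g s ε := by
    filter_upwards [hle hAg, hle hpsd', hBpsd] with ε h1 h2 h3 s
    rw [← h1]
    refine congrFun (sortedEigenvalue_eq_of_charpoly_eq h3.1 h2.1 ?_) s
    rw [Matrix.charpoly_mul_comm, ← mul_assoc, mul_eq_one_comm.1 hQ, one_mul]
  have hM : ∀ p q, Tendsto (fun ε : ℝ => B ε p q / ε ^ ((p : ℕ) + q)) (𝓝[>] 0) (𝓝 (M p q)) := by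
    intro p q
    have h := hK.tendsto_bilin ha (x := x) (v := fun i => Q i p) (w := fun i => Q i q) p.2.le q.2.le
      (hann p) (hann q)
    refine h.congr fun ε => ?_
    congr 1
    simp only [B, Matrix.mul_apply, Finset.sum_mul, Matrix.transpose_apply]
    rw [Finset.sum_comm]
    refine Finset.sum_congr rfl fun j _ => Finset.sum_congr rfl fun i _ => ?_
    simp only [A, scaledKernelMatrix, Matrix.of_apply]
    ring
  have hgO : ∀ s, g s =O[𝓝[>] 0] fun ε : ℝ => ε ^ (2 * (s : ℕ)) := fun s =>
    (isBigO_sortedEigenvalue_of_graded hBpsd hM s).congr' (hsort.mono fun ε h => h s)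
      EventuallyEq.rfl
  -- The bound holds only for `ε > 0`, yet it fixes the order of vanishing of the analytic `g s`;
  -- the coefficient sought is `h s 0`.
  choose h hh hgh using fun s => (hg s).exists_eq_pow_mul_of_isBigO (l := 𝓝[>] 0)
    (nhdsWithin_mono 0 fun ε (hε : 0 < ε) => hε.ne') (hgO s)
  refine ⟨fun s => h s 0, fun s => ?_, fun s => ?_⟩
  -- The relative error `O(ε)` is the differentiability of `h s` at `0`.
  · have hO : (fun ε => h s ε - h s 0) =O[𝓝[≥] 0] fun ε : ℝ => ε := by
      simpa using (hh s).differentiableAt.isBigO_sub.mono nhdsWithin_le_nhds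
    refine ((Asymptotics.isBigO_refl (fun ε : ℝ => ε ^ (2 * (s : ℕ))) (𝓝[≥] 0)).mul hO).congr' ?_
      (Eventually.of_forall fun ε => (pow_succ _ _).symm)
    filter_upwards [hAg, nhdsWithin_le_nhds (hgh s)] with ε h1 h2
    rw [h1, h2]
    ring
  · rw [prod_leading_eq_det_of_graded (hBpsd.mono fun _ h => h.1) hM (fun i => ?_) s,
      det_leadingBlock_mul_mul, det_gram_vandermondeUpTo hQ hann]
    · rfl
    · refine ((hh i).continuousAt.tendsto.mono_left
        (nhdsWithin_le_nhds (s := Set.Ioi 0))).congr' ?_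
      filter_upwards [hsort, nhdsWithin_le_nhds (hgh i), self_mem_nhdsWithin]
        with ε h1 h2 (h3 : 0 < ε)
      rw [h1, h2, mul_div_cancel_left₀ _ (pow_pos h3 _).ne']
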